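/- Let $d\ge 1$ and consider $L^2(\mathbb{R}^d)=L^2(\mathbb{R}^d,dx;\mathbb{C})$ with Lebesgue measure. For a bounded Borel set $B\subset\mathbb{R}^d$ let $\mathcal{P}_B f=\mathbf 1_B f$. Let $\mathcal{K}$ be an orthogonal projection on $L^2(\mathbb{R}^d)$ that is locally of trace class, i.e. $\mathcal{M}_B:=\mathcal{P}_B\mathcal{K}\mathcal{P}_B$ is of trace class for every bounded Borel set $B$, and let $K:\mathbb{R}^d\times\mathbb{R}^d\to\mathbb{C}$ be its (measurable) kernel: $\mathcal{K}f(x)=\int K(x,y)f(y)\,dy$ for all $f\in L^2(\mathbb{R}^d)$ and almost every $x$, with the values on the diagonal fixed by the reproducing property $K(x,x)=\int K(x,y)K(y,x)\,dy$ for almost every $x$. **Accumulated spectrogram.** For a bounded Borel set $B$, write $\mathcal{M}_B=\sum_{j\ge1}\mu_j^{(B)}\,\Phi_j^{(B)}\otimes\Phi_j^{(B)}$ with $(\Phi_j^{(B)})_{j\ge 1}$ orthonormal and $\mu_1^{(B)}\ge\mu_2^{(B)}\ge\dots\ge0$ (eigenvalues counted with multiplicity), let $\mathcal{K}\mathcal{P}_B=\mathcal{W}_B\sqrt{\mathcal{M}_B}$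 be the polar decomposition (with $\mathcal{W}_B=0$ on $\ker \mathcal{M}_B$), put $\Psi_j^{(B)}=\mathcal{W}_B\Phi_j^{(B)}$, and let $$\rho_B(x)=\sum_{j=1}^{N_B}\bigl|\Psi_j^{(B)}(x)\bigr|^2,\qquad N_B=\lceil \mathrm{Tr}\,\mathcal{M}_B\rceil .$$ **Hyperuniformity.** Let $\mathbb{P}$ be the determinantal point process on $\mathbb{R}^d$ with kernel $K$: a simple point process, that is, a probability measure on the nonnegative-integer valued Radon measures $\Xi$ on $\mathbb{R}^d$, supported on those with $\Xi(\{x\})\in\{0,1\}$ for all $x$, whose $n$-th correlation function with respect to Lebesgue measure is $\det(K(x_i,x_j))_{i,j=1}^n$ for every $n\ge1$. Let $\Lambda\subset\mathbb{R}^d$ be a bounded Borel set. One says that $\mathbb{P}$ is hyperuniform along $\{R\Lambda\}_{R>0}$ if $\Xi(B)\in L^2(\mathbb{P})$ for every bounded Borel set $B$ and, as $R\to+\infty$, $$\mathbb{E}[\Xi(R\Lambda)]\to\infty\quad\text{and}\quad \frac{\mathrm{var}(\Xi(R\Lambda))}{\mathbb{E}[\Xi(R\Lambda)]}\to0 .$$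 **Statement.** Assume that $K(x,x)=1$ for almost every $x\in\mathbb{R}^d$ and that $\mathbb{P}$ is hyperuniform along $\{R\Lambda\}_{R>0}$. Then, for every choice of the spectral decompositions of the operators $\mathcal{M}_{R\Lambda}$, $R>0$, the functions $x\mapsto\rho_{R\Lambda}(Rx)$ belong to $L^1(\mathbb{R}^d)$ and $$\rho_{R\Lambda}(R\,\cdot)\longrightarrow\mathbf 1_\Lambda\quad\text{in }L^1(\mathbb{R}^d,dx)\text{ as }R\to+\infty .$$ -/

import Mathlib

open MeasureTheory Filter Topology
open scoped ENNReal Pointwise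

namespace DPP

noncomputable section

/-! ### Operators on a complex Hilbert space -/

section Hilbert

universe u

/-- `T` is of trace class: for an orthonormal basis `(bᵢ)`, the sum of the (nonnegative) numbers
`⟨|T| bᵢ, bᵢ⟩` is finite, where `|T| = √(T* T)`. -/
def IsTraceClass {H : Type u} [NormedAddCommGroup H] [InnerProductSpace ℂ H] [CompleteSpace H]
    (T : H →L[ℂ] H) : Prop :=
  ∃ (ι : Type u) (b : HilbertBasis ι ℂ H), Summable fun i => (inner ℂ (b i) (CFC.abs T (b i))).re

/-- The trace `∑ᵢ ⟨T bᵢ, bᵢ⟩` of a trace class operator, computed in some orthonormal basis. For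
trace class operators the sum converges and does not depend on the basis. -/
def trace {H : Type u} [NormedAddCommGroup H] [InnerProductSpace ℂ H] [CompleteSpace H]
    (T : H →L[ℂ] H) : ℂ :=
  ∑' i, inner ℂ ((exists_hilbertBasis ℂ H).choose_spec.choose i)
    (T ((exists_hilbertBasis ℂ H).choose_spec.choose i))

/-- `M = ∑ⱼ μⱼ Φⱼ ⊗ Φⱼ` with `Φ` an orthonormal sequence (of eigenvectors) and `μ` the nonincreasing
sequence of nonnegative eigenvalues. Eigenvalues are repeated according to multiplicity.
If `M` has finite rank the sequence `μ` ends with zeros, and the corresponding `Φⱼ` lie in `ker M`;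
if `M` has infinite rank the sequence exhausts the positive eigenvalues. -/
structure IsSpectralDecomposition {H : Type u} [NormedAddCommGroup H] [InnerProductSpace ℂ H]
    (M : H →L[ℂ] H) (μ : ℕ → ℝ) (Φ : ℕ → H) : Prop where
  orthonormal : Orthonormal ℂ Φ
  antitone : Antitone μ
  nonneg : ∀ j, 0 ≤ μ j
  hasSum : ∀ f : H, HasSum (fun j => ((μ j : ℂ) * inner ℂ (Φ j) f) • Φ j) (M f)

/-- The closure of the range of `|T|`. -/
abbrev absRange {H : Type u} [NormedAddCommGroup H] [InnerProductSpace ℂ H] [CompleteSpace H]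
    (T : H →L[ℂ] H) : Submodule ℂ H :=
  (LinearMap.range (CFC.abs T).toLinearMap).topologicalClosure

/-- `|T|` as a map with values in the closure of its range. -/
def absToRange {H : Type u} [NormedAddCommGroup H] [InnerProductSpace ℂ H] [CompleteSpace H]
    (T : H →L[ℂ] H) : H →ₗ[ℂ] absRange T :=
  (CFC.abs T).toLinearMap.codRestrict (absRange T)
    (fun f => Submodule.le_topologicalClosure _ (LinearMap.mem_range_self _ f))

/-- The partial isometry `W` in the polar decomposition `T = W |T|`: on the closure of the range of
`|T|` it is the continuous extension of `|T| f ↦ T f`, and it vanishes on the orthogonal complement,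
which is `ker T`. -/
def polarIsometry {H : Type u} [NormedAddCommGroup H] [InnerProductSpace ℂ H] [CompleteSpace H]
    (T : H →L[ℂ] H) : H →L[ℂ] H :=
  (T.toLinearMap.extendOfNorm (absToRange T)).comp (absRange T).orthogonalProjectionOnto

theorem norm_abs_apply {H : Type u} [NormedAddCommGroup H] [InnerProductSpace ℂ H]
    [CompleteSpace H] (T : H →L[ℂ] H) (f : H) : ‖CFC.abs T f‖ = ‖T f‖ := by
  have hsa : star (CFC.abs T) = CFC.abs T := (CFC.abs_nonneg T).isSelfAdjoint.star_eq
  have h : inner ℂ (CFC.abs T f) (CFC.abs T f) = inner ℂ (T f) (T f) := by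
    calc inner ℂ (CFC.abs T f) (CFC.abs T f)
        = inner ℂ ((star (CFC.abs T)) f) (CFC.abs T f) := by rw [hsa]
      _ = inner ℂ f ((CFC.abs T * CFC.abs T) f) := by
          rw [ContinuousLinearMap.star_eq_adjoint, ContinuousLinearMap.adjoint_inner_left]; rfl
      _ = inner ℂ f ((star T * T) f) := by rw [CFC.abs_mul_abs]
      _ = inner ℂ (T f) (T f) := by
          rw [ContinuousLinearMap.star_eq_adjoint, mul_apply_eq_comp,
            ContinuousLinearMap.adjoint_inner_right]
  rw [inner_self_eq_norm_sq_to_K, inner_self_eq_norm_sq_to_K] at h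
  have h2 : ‖CFC.abs T f‖ ^ 2 = ‖T f‖ ^ 2 := by exact_mod_cast h
  exact (sq_eq_sq₀ (norm_nonneg _) (norm_nonneg _)).1 h2

theorem denseRange_absToRange {H : Type u} [NormedAddCommGroup H] [InnerProductSpace ℂ H]
    [CompleteSpace H] (T : H →L[ℂ] H) : DenseRange (absToRange T) := by
  rintro ⟨x, hx⟩
  rw [closure_subtype]
  have hx' : x ∈ closure (LinearMap.range (CFC.abs T).toLinearMap : Set H) := by
    rw [← Submodule.topologicalClosure_coe]
    exact hx
  refine closure_mono ?_ hx'
  rintro _ ⟨f, rfl⟩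
  exact ⟨absToRange T f, ⟨f, rfl⟩, rfl⟩

/-- The polar decomposition `T = W |T|`. -/
theorem polarIsometry_abs {H : Type u} [NormedAddCommGroup H] [InnerProductSpace ℂ H]
    [CompleteSpace H] (T : H →L[ℂ] H) (f : H) : polarIsometry T (CFC.abs T f) = T f := by
  have h1 : (absRange T).orthogonalProjectionOnto (CFC.abs T f) = absToRange T f :=
    Submodule.orthogonalProjectionOnto_mem_subspace_eq_self (absToRange T f)
  rw [polarIsometry, ContinuousLinearMap.comp_apply, h1]
  exact LinearMap.extendOfNorm_eq (denseRange_absToRange T)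
    ⟨1, fun x => by simpa [absToRange] using! (norm_abs_apply T x).ge⟩ f

theorem polarIsometry_of_mem_ker {H : Type u} [NormedAddCommGroup H] [InnerProductSpace ℂ H]
    [CompleteSpace H] (T : H →L[ℂ] H) (g : H) (hg : T g = 0) : polarIsometry T g = 0 := by
  have hsa : star (CFC.abs T) = CFC.abs T := (CFC.abs_nonneg T).isSelfAdjoint.star_eq
  have h0 : CFC.abs T g = 0 := by rw [← norm_eq_zero, norm_abs_apply, hg, norm_zero]
  have h1 : g ∈ (absRange T)ᗮ := by
    rw [Submodule.orthogonal_closure, Submodule.mem_orthogonal]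
    rintro _ ⟨f, rfl⟩
    change inner ℂ (CFC.abs T f) g = 0
    rw [← hsa, ContinuousLinearMap.star_eq_adjoint, ContinuousLinearMap.adjoint_inner_left, h0,
      inner_zero_right]
  rw [polarIsometry, ContinuousLinearMap.comp_apply,
    Submodule.orthogonalProjectionOnto_apply_of_mem_orthogonal h1, map_zero]

end Hilbert

/-! ### Locally trace class operators and accumulated spectrograms on `L²(X, ν)` -/

section L2

theorem memLp_indicator {X : Type*} [MeasurableSpace X] (ν : Measure X) {s : Set X}
    (hs : MeasurableSet s) (f : Lp ℂ 2 ν) : MemLp (s.indicator (f : X → ℂ)) 2 ν :=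
  MemLp.indicator hs (Lp.memLp f)

/-- Multiplication by `1_s` on `L²(X, ν)`, as a function. -/
def restrictFun {X : Type*} [MeasurableSpace X] (ν : Measure X) {s : Set X}
    (hs : MeasurableSet s) (f : Lp ℂ 2 ν) : Lp ℂ 2 ν :=
  MemLp.toLp (s.indicator (f : X → ℂ)) (memLp_indicator ν hs f)

theorem restrictFun_coeFn {X : Type*} [MeasurableSpace X] (ν : Measure X) {s : Set X}
    (hs : MeasurableSet s) (f : Lp ℂ 2 ν) : restrictFun ν hs f =ᵐ[ν] s.indicator f := by
  exact MemLp.coeFn_toLp (memLp_indicator ν hs f)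

theorem restrictFun_add {X : Type*} [MeasurableSpace X] (ν : Measure X) {s : Set X}
    (hs : MeasurableSet s) (f g : Lp ℂ 2 ν) :
    restrictFun ν hs (f + g) = restrictFun ν hs f + restrictFun ν hs g := by
  apply Lp.ext
  filter_upwards [restrictFun_coeFn ν hs (f + g), restrictFun_coeFn ν hs f,
    restrictFun_coeFn ν hs g, Lp.coeFn_add f g,
    Lp.coeFn_add (restrictFun ν hs f) (restrictFun ν hs g)] with x h1 h2 h3 h4 h5
  rw [h1, h5, Pi.add_apply, h2, h3]
  by_cases hx : x ∈ s
  · rw [Set.indicator_of_mem hx, Set.indicator_of_mem hx, Set.indicator_of_mem hx, h4,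
      Pi.add_apply]
  · rw [Set.indicator_of_notMem hx, Set.indicator_of_notMem hx, Set.indicator_of_notMem hx,
      add_zero]

theorem restrictFun_smul {X : Type*} [MeasurableSpace X] (ν : Measure X) {s : Set X}
    (hs : MeasurableSet s) (c : ℂ) (f : Lp ℂ 2 ν) :
    restrictFun ν hs (c • f) = c • restrictFun ν hs f := by
  apply Lp.ext
  filter_upwards [restrictFun_coeFn ν hs (c • f), restrictFun_coeFn ν hs f,
    Lp.coeFn_smul c f, Lp.coeFn_smul c (restrictFun ν hs f)] with x h1 h2 h4 h5
  rw [h1, h5, Pi.smul_apply, h2]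
  by_cases hx : x ∈ s
  · rw [Set.indicator_of_mem hx, Set.indicator_of_mem hx, h4, Pi.smul_apply]
  · rw [Set.indicator_of_notMem hx, Set.indicator_of_notMem hx, smul_zero]

theorem norm_restrictFun_le {X : Type*} [MeasurableSpace X] (ν : Measure X) {s : Set X}
    (hs : MeasurableSet s) (f : Lp ℂ 2 ν) : ‖restrictFun ν hs f‖ ≤ 1 * ‖f‖ := by
  rw [one_mul]
  refine Lp.norm_le_norm_of_ae_le ?_
  filter_upwards [restrictFun_coeFn ν hs f] with x hx
  rw [hx]
  exact norm_indicator_le_norm_self _ _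

open Classical in
/-- The restriction operator `f ↦ 1_s f` on `L²(X, ν)`, for a measurable set `s`
(the value for a non-measurable `s` is irrelevant). -/
def restrictOp {X : Type*} [MeasurableSpace X] (ν : Measure X) (s : Set X) :
    Lp ℂ 2 ν →L[ℂ] Lp ℂ 2 ν :=
  if hs : MeasurableSet s then
    LinearMap.mkContinuous
      { toFun := restrictFun ν hs
        map_add' := restrictFun_add ν hs
        map_smul' := restrictFun_smul ν hs }
      1 (norm_restrictFun_le ν hs)
  else 0

theorem restrictOp_coeFn {X : Type*} [MeasurableSpace X] (ν : Measure X) {s : Set X}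
    (hs : MeasurableSet s) (f : Lp ℂ 2 ν) : restrictOp ν s f =ᵐ[ν] s.indicator f := by
  rw [restrictOp, dif_pos hs]
  exact restrictFun_coeFn ν hs f

/-- `M_s = P_s 𝒦 P_s`. -/
def compression {X : Type*} [MeasurableSpace X] {ν : Measure X} (𝒦 : Lp ℂ 2 ν →L[ℂ] Lp ℂ 2 ν)
    (s : Set X) : Lp ℂ 2 ν →L[ℂ] Lp ℂ 2 ν :=
  restrictOp ν s ∘L 𝒦 ∘L restrictOp ν s

/-- `𝒦` is locally of trace class: `P_s 𝒦 P_s` is of trace class for every bounded Borel set `s`. -/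
def IsLocallyTraceClass {X : Type*} [PseudoMetricSpace X] [MeasurableSpace X] {ν : Measure X}
    (𝒦 : Lp ℂ 2 ν →L[ℂ] Lp ℂ 2 ν) : Prop :=
  ∀ s : Set X, MeasurableSet s → Bornology.IsBounded s → IsTraceClass (compression 𝒦 s)

/-- `K` is the kernel of the orthogonal projection `𝒦` on `L²(X, ν)`, that is, `𝒦` is the integral
operator with kernel `K`. The operator determines `K` only up to null sets of `X × X`, which says
nothing about the diagonal; the diagonal is the one given by the reproducing property
`K(x, z) = ∫ K(x, y) K(y, z) dν(y)` of the kernel of a projection. -/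
structure IsProjectionKernel {X : Type*} [MeasurableSpace X] {ν : Measure X}
    (𝒦 : Lp ℂ 2 ν →L[ℂ] Lp ℂ 2 ν) (K : X → X → ℂ) : Prop where
  measurable : Measurable (Function.uncurry K)
  apply : ∀ f : Lp ℂ 2 ν, ∀ᵐ x ∂ν,
    Integrable (fun y => K x y * f y) ν ∧ 𝒦 f x = ∫ y, K x y * f y ∂ν
  diagonal : ∀ᵐ x ∂ν, K x x = ∫ y, K x y * K y x ∂ν

/-- `N_s`, the smallest integer that is at least the trace of `M_s = P_s 𝒦 P_s`. -/
def spectrogramCount {X : Type*} [MeasurableSpace X] {ν : Measure X}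
    (𝒦 : Lp ℂ 2 ν →L[ℂ] Lp ℂ 2 ν) (s : Set X) : ℕ :=
  ⌈(trace (compression 𝒦 s)).re⌉₊

/-- The accumulated spectrogram `ρ_s = ∑_{j ≤ N_s} |Ψ_j|²` associated to `(𝒦, s)` and to the
eigenfunctions `Φ_j` of `M_s = P_s 𝒦 P_s`. Here `Ψ_j = W_s Φ_j`, where `𝒦 P_s = W_s √M_s` is the
polar decomposition. (The sequence `Φ` starts at index `0`.) -/
def accumulatedSpectrogram {X : Type*} [MeasurableSpace X] {ν : Measure X}
    (𝒦 : Lp ℂ 2 ν →L[ℂ] Lp ℂ 2 ν) (s : Set X) (Φ : ℕ → Lp ℂ 2 ν) (x : X) : ℝ :=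
  ∑ j ∈ Finset.range (spectrogramCount 𝒦 s),
    ‖(polarIsometry (𝒦 ∘L restrictOp ν s) (Φ j) : Lp ℂ 2 ν) x‖ ^ 2

end L2

/-! ### Point processes -/

section PointProcess

/-- The space of configurations: nonnegative-integer valued Radon measures (for the spaces
considered here, Borel measures that are locally finite). -/
def Configuration (X : Type*) [TopologicalSpace X] [MeasurableSpace X] : Type _ :=
  {ξ : Measure X // IsLocallyFiniteMeasure ξ ∧
    ∀ B : Set X, MeasurableSet B → ∃ n : ℕ∞, ξ B = (n : ℝ≥0∞)}

/-- The σ-algebra on configurations generated by the counts `ξ ↦ ξ(B)`; on a locally compact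
separable metric space it is the Borel σ-algebra of the vague topology. -/
instance (X : Type*) [TopologicalSpace X] [MeasurableSpace X] :
    MeasurableSpace (Configuration X) :=
  inferInstanceAs (MeasurableSpace {ξ : Measure X // IsLocallyFiniteMeasure ξ ∧
    ∀ B : Set X, MeasurableSet B → ∃ n : ℕ∞, ξ B = (n : ℝ≥0∞)})

/-- The number of points `ξ(B)` of the configuration in `B`, as a real number. -/
def count {X : Type*} [TopologicalSpace X] [MeasurableSpace X] (B : Set X)
    (ξ : Configuration X) : ℝ :=
  (ξ.1 B).toReal

/-- `P` is supported on simple configurations. -/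
def IsSimple {X : Type*} [TopologicalSpace X] [MeasurableSpace X]
    (P : Measure (Configuration X)) : Prop :=
  ∀ᵐ ξ ∂P, ∀ x : X, ξ.1 {x} = 0 ∨ ξ.1 {x} = 1

/-- `ρ` is the `n`-th correlation function of the point process `P` with respect to `ν^{⊗n}`:
the expectation of the sum of `f(x₁, …, xₙ)` over pairwise distinct points of the configuration is
`∫ f ρ dν^{⊗n}`, for all nonnegative measurable `f`. The sum and the integral are computed in
`[0, ∞]`, which makes sense since `ρ` is nonnegative almost everywhere. -/
structure IsCorrelationFunction {X : Type*} [TopologicalSpace X] [MeasurableSpace X]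
    (P : Measure (Configuration X)) (ν : Measure X) (n : ℕ) (ρ : (Fin n → X) → ℂ) : Prop where
  aemeasurable : AEMeasurable ρ (Measure.pi fun _ => ν)
  nonneg : ∀ᵐ x ∂(Measure.pi fun _ : Fin n => ν), 0 ≤ (ρ x).re ∧ (ρ x).im = 0
  lintegral_sum : ∀ f : (Fin n → X) → ℝ≥0∞, Measurable f →
    ∫⁻ ξ, ∑' x : {x : Fin n → X // Function.Injective x ∧ ∀ i, x i ∈ ξ.1.support}, f x.1 ∂P =
      ∫⁻ x, f x * ENNReal.ofReal (ρ x).re ∂(Measure.pi fun _ : Fin n => ν)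

/-- `P` is the determinantal point process on `(X, ν)` with kernel `K`. -/
structure IsDeterminantal {X : Type*} [TopologicalSpace X] [MeasurableSpace X]
    (P : Measure (Configuration X)) (ν : Measure X) (K : X → X → ℂ) : Prop where
  simple : IsSimple P
  correlation : ∀ n : ℕ, 1 ≤ n →
    IsCorrelationFunction P ν n fun x => (Matrix.of fun i j => K (x i) (x j)).det

/-- `P` is hyperuniform along the family of bounded Borel sets `(Λ_t)`, as `t → l`: the number of
points in any bounded Borel set is square integrable, `𝔼[ξ(Λ_t)] → ∞`, and
`Var(ξ(Λ_t)) / 𝔼[ξ(Λ_t)] → 0`. -/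
structure IsHyperuniformAlong {X : Type*} [PseudoMetricSpace X] [MeasurableSpace X]
    (P : Measure (Configuration X)) {T : Type*} (Λ : T → Set X) (l : Filter T) : Prop where
  memLp : ∀ B : Set X, MeasurableSet B → Bornology.IsBounded B → MemLp (count B) 2 P
  tendsto_expectation : Tendsto (fun t => ∫ ξ, count (Λ t) ξ ∂P) l atTop
  tendsto_ratio : Tendsto (fun t =>
    ProbabilityTheory.variance (count (Λ t)) P / ∫ ξ, count (Λ t) ξ ∂P) l (𝓝 0)

end PointProcess

end

end DPP

/-!
The idea is to bound, for one set `s` of finite measure, the `L¹` distance from the accumulated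
spectrogram `ρ_s` to `1_s` by the number variance of the point process in `s`, and then to rescale.

Put `T = 𝒦 P_s`, so that `P_s 𝒦 P_s = T* T`, and `g(x) = ∫_s |K(x, y)|² dy`. The kernel is Hermitian
almost everywhere and reproducing (`IsProjectionKernel.ae_eq_conj`,
`IsProjectionKernel.ae_kernelMass_univ`), so `K(x, x) = 1` gives `0 ≤ g ≤ 1` and `∫ g = |s|`. For
almost every `x`, `T f (x)` is the inner product of `f` with the conjugate of the section `K(x, ·)`
cut off to `s`, a vector of squared norm `g(x)` (`IsProjectionKernel.ae_exists_inner`). Hence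
Parseval's identity shows that the trace of `T* T`, which is the sum of its eigenvalues, equals
`|s|`, and Bessel's inequality gives `∑_{j<n} |T Φ_j|² ≤ g`. Since `Ψ_j = T Φ_j / √μ_j` (and `Ψ_j =
0` if `μ_j = 0`), the triangle inequality through `∑_{j<N} μ_j |Ψ_j|² = ∑_{j<N} |T Φ_j|²` and `g`
bounds `‖ρ_s - 1_s‖₁` by `∑_{j<N} (1 - μ_j) + (|s| - ∑_{j<N} μ_j) + ‖g - 1_s‖₁`. With `v = |s| - ∫_s
g` the last term is `2 v`, and an elementary argument on `∑ μ_j (1 - μ_j) ≤ v` with `N = ⌈|s|⌉`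
bounds the tail `|s| - ∑_{j<N} μ_j` by `v` (`sub_sum_range_le`). In total, `‖ρ_s - 1_s‖₁ ≤ 1 + 4 v`
(`IsProjectionKernel.integral_abs_accumulatedSpectrogram_sub_le`).

On the probabilistic side, a simple configuration counts the points of its support, so the first two
correlation functions give the factorial moments of the count: the mean is `|s|` and the variance is
exactly `v` (`IsDeterminantal.variance_count`). For `s = R Λ` the rescaled distance is at most
`R^{-d} (1 + 4 v)`, and `R^{-d} v` is `|Λ|` times the ratio of variance to mean, which tends to `0`.
-/

/-! ### Orthonormal families, spectral decompositions and the polar isometry -/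

namespace DPP

section Hilbert

variable {H : Type*} [NormedAddCommGroup H] [InnerProductSpace ℂ H]

theorem enorm_inner_sq (x y : H) : ‖inner ℂ x y‖ₑ ^ 2 = ENNReal.ofReal (‖inner ℂ x y‖ ^ 2) := by
  rw [← ofReal_norm, ENNReal.ofReal_pow (norm_nonneg _)]

/-- Parseval's identity in `[0, ∞]`. -/
theorem _root_.HilbertBasis.tsum_enorm_inner_sq {ι : Type*} (b : HilbertBasis ι ℂ H) (x : H) :
    ∑' i, ‖inner ℂ (b i) x‖ₑ ^ 2 = ‖x‖ₑ ^ 2 := by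
  have h := b.hasSum_inner_mul_inner x x
  have h2 : HasSum (fun i => ‖inner ℂ (b i) x‖ ^ 2) (‖x‖ ^ 2) := by
    have h3 := Complex.hasSum_re h
    convert! h3 using 1
    · ext i
      rw [← inner_conj_symm x (b i), Complex.conj_mul', ← Complex.ofReal_pow, Complex.ofReal_re]
    · rw [inner_self_eq_norm_sq_to_K]
      norm_cast
  simp_rw [enorm_inner_sq]
  rw [← ENNReal.ofReal_tsum_of_nonneg (fun _ => by positivity) h2.summable, h2.tsum_eq,
    ENNReal.ofReal_pow (norm_nonneg _), ofReal_norm]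

/-- Distinct members of an orthonormal family are at distance `√2`, so the family is countable in a
separable space. -/
theorem _root_.Orthonormal.countable [TopologicalSpace.SeparableSpace H] {ι : Type*} {v : ι → H}
    (hv : Orthonormal ℂ v) : Countable ι := by
  have hd : ∀ i j, i ≠ j → ‖v i - v j‖ ^ 2 = 2 := by
    intro i j hij
    rw [@norm_sub_sq ℂ, hv.1, hv.1, hv.2 hij]
    norm_num
  have hdisj : (Set.univ : Set ι).PairwiseDisjoint fun i => Metric.ball (v i) (1 / 2) := by
    intro i _ j _ hij
    refine Metric.ball_disjoint_ball ?_
    have h := hd i j hij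
    rw [dist_eq_norm]
    nlinarith [norm_nonneg (v i - v j)]
  exact Set.countable_univ_iff.1 (hdisj.countable_of_isOpen (fun _ _ => Metric.isOpen_ball)
    fun i _ => ⟨v i, Metric.mem_ball_self (by norm_num)⟩)

variable {M : H →L[ℂ] H} {μ : ℕ → ℝ} {Φ : ℕ → H}

theorem IsSpectralDecomposition.apply_eq (h : IsSpectralDecomposition M μ Φ) (j : ℕ) :
    M (Φ j) = (μ j : ℂ) • Φ j := by
  have h1 := h.hasSum (Φ j)
  have h2 := hasSum_single (f := fun i => ((μ i : ℂ) * inner ℂ (Φ i) (Φ j)) • Φ i) j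
    (fun i hi => by simp [h.orthonormal.2 hi])
  rw [h1.unique h2]
  simp [h.orthonormal.1 j, inner_self_eq_norm_sq_to_K]

theorem IsSpectralDecomposition.hasSum_inner (h : IsSpectralDecomposition M μ Φ) (f : H) :
    HasSum (fun j => μ j * ‖inner ℂ (Φ j) f‖ ^ 2) (inner ℂ f (M f)).re := by
  have h1 := (h.hasSum f).mapL (innerSL ℂ f)
  have h2 := Complex.hasSum_re h1
  convert! h2 using 1
  ext j
  simp only [map_smul, innerSL_apply_apply, smul_eq_mul]
  rw [← inner_conj_symm f (Φ j), mul_assoc, Complex.mul_conj', Complex.re_ofReal_mul,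
    ← Complex.ofReal_pow, Complex.ofReal_re]

/-- The trace of a positive operator, computed in any orthonormal basis, is the sum of the
eigenvalues. -/
theorem IsSpectralDecomposition.tsum_ofReal (h : IsSpectralDecomposition M μ Φ) {ι : Type*}
    (b : HilbertBasis ι ℂ H) :
    ∑' j, ENNReal.ofReal (μ j) = ∑' i, ENNReal.ofReal (inner ℂ (b i) (M (b i))).re := by
  have h1 : ∀ i, ENNReal.ofReal (inner ℂ (b i) (M (b i))).re =
      ∑' j, ENNReal.ofReal (μ j) * ‖inner ℂ (b i) (Φ j)‖ₑ ^ 2 := by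
    intro i
    have h2 := h.hasSum_inner (b i)
    rw [← h2.tsum_eq, ENNReal.ofReal_tsum_of_nonneg
      (fun j => mul_nonneg (h.nonneg j) (by positivity)) h2.summable]
    refine tsum_congr fun j => ?_
    rw [ENNReal.ofReal_mul (h.nonneg j), enorm_inner_sq, norm_inner_symm]
  simp_rw [h1]
  rw [ENNReal.tsum_comm]
  refine tsum_congr fun j => ?_
  rw [ENNReal.tsum_mul_left, b.tsum_enorm_inner_sq, ← ofReal_norm, h.orthonormal.1 j]
  simp

variable [CompleteSpace H]

/-- If `T* T φ = m φ`, then `|T| φ = √m φ`: the vector `u = (|T| - √m) φ` satisfies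
`|T| u = -√m u`, which forces `u = 0` since `|T|` is positive. -/
theorem abs_apply_of_eigenvector {T : H →L[ℂ] H} {φ : H} {m : ℝ} (hm : 0 ≤ m)
    (h : ContinuousLinearMap.adjoint T (T φ) = (m : ℂ) • φ) :
    CFC.abs T φ = (√m : ℂ) • φ := by
  have hsa : star (CFC.abs T) = CFC.abs T := (CFC.abs_nonneg T).isSelfAdjoint.star_eq
  have hsq : CFC.abs T (CFC.abs T φ) = (m : ℂ) • φ := by
    rw [← h, ← ContinuousLinearMap.star_eq_adjoint]
    exact congrArg (fun S : H →L[ℂ] H => S φ) (CFC.abs_mul_abs T)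
  rcases hm.eq_or_lt with rfl | hm
  · have : ‖CFC.abs T φ‖ ^ 2 = 0 := by
      have h1 : inner ℂ (CFC.abs T φ) (CFC.abs T φ) = 0 := by
        nth_rewrite 1 [← hsa]
        rw [ContinuousLinearMap.star_eq_adjoint, ContinuousLinearMap.adjoint_inner_left, hsq]
        simp
      rw [inner_self_eq_zero.1 h1]; simp
    have h2 : CFC.abs T φ = 0 := by simpa using this
    simp [h2]
  · have hs : (0 : ℝ) < √m := Real.sqrt_pos.2 hm
    set u := CFC.abs T φ - (√m : ℂ) • φ with hu
    have hTu : CFC.abs T u = -(√m : ℂ) • u := by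
      have h2 : (m : ℂ) = (√m : ℂ) * (√m : ℂ) := by
        rw [← Complex.ofReal_mul, Real.mul_self_sqrt hm.le]
      rw [hu, map_sub, map_smul, hsq, h2]
      module
    have hpos : 0 ≤ (inner ℂ (CFC.abs T u) u).re :=
      ((ContinuousLinearMap.nonneg_iff_isPositive _).1 (CFC.abs_nonneg T)).re_inner_nonneg_left u
    rw [hTu, inner_smul_left, inner_self_eq_norm_sq_to_K] at hpos
    have h3 : (((starRingEnd ℂ) (-(√m : ℂ))) * ((‖u‖ : ℂ)) ^ 2).re = -(√m * ‖u‖ ^ 2) := by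
      rw [map_neg, Complex.conj_ofReal, ← Complex.ofReal_pow, ← Complex.ofReal_neg,
        ← Complex.ofReal_mul, Complex.ofReal_re, neg_mul]
    erw [h3] at hpos
    have h4 : ‖u‖ = 0 := by
      by_contra h5
      have : 0 < ‖u‖ ^ 2 := by positivity
      nlinarith
    exact sub_eq_zero.1 (norm_eq_zero.1 h4)

theorem norm_apply_sq_of_eigenvector {T : H →L[ℂ] H} {φ : H} {m : ℝ} (hφ : ‖φ‖ = 1)
    (h : ContinuousLinearMap.adjoint T (T φ) = (m : ℂ) • φ) : ‖T φ‖ ^ 2 = m := by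
  have h1 : inner ℂ (T φ) (T φ) = (m : ℂ) := by
    rw [← ContinuousLinearMap.adjoint_inner_right, h, inner_smul_right,
      inner_self_eq_norm_sq_to_K, hφ]
    simp
  rw [inner_self_eq_norm_sq_to_K] at h1
  exact Complex.ofReal_injective (by simpa using h1)

/-- On an eigenvector `φ` of `T* T` for the eigenvalue `m ≠ 0` the polar isometry is `T φ / √m`.
Without the division the identity also holds for `m = 0`, where `T φ = 0`. -/
theorem sqrt_smul_polarIsometry {T : H →L[ℂ] H} {φ : H} {m : ℝ} (hm : 0 ≤ m)
    (h : ContinuousLinearMap.adjoint T (T φ) = (m : ℂ) • φ) :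
    (√m : ℂ) • polarIsometry T φ = T φ := by
  rw [← map_smul, ← abs_apply_of_eigenvector hm h, polarIsometry_abs]

theorem norm_polarIsometry_le_of_eigenvector {T : H →L[ℂ] H} {φ : H} {m : ℝ} (hm : 0 ≤ m)
    (hφ : ‖φ‖ = 1) (h : ContinuousLinearMap.adjoint T (T φ) = (m : ℂ) • φ) :
    ‖polarIsometry T φ‖ ≤ 1 := by
  have h1 := norm_apply_sq_of_eigenvector hφ h
  rcases hm.eq_or_lt with rfl | hm
  · rw [polarIsometry_of_mem_ker T φ (by simpa using h1)]
    simp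
  · have h2 := congrArg norm (sqrt_smul_polarIsometry hm.le h)
    rw [norm_smul, Complex.norm_real, Real.norm_of_nonneg (Real.sqrt_nonneg _)] at h2
    rw [← h2, mul_pow, Real.sq_sqrt hm.le] at h1
    have h3 : ‖polarIsometry T φ‖ ^ 2 = 1 := by
      field_simp at h1
      exact h1
    nlinarith [norm_nonneg (polarIsometry T φ)]

end Hilbert

end DPP

/-! ### The kernel of an orthogonal projection on `L²` -/

namespace DPP

section Kernel

/-- An integrable function on a product of finite measure spaces whose integrals over all
measurable rectangles vanish is zero almost everywhere. -/
theorem ae_eq_zero_of_forall_setIntegral_prod_eq_zero {X Y E : Type*} [MeasurableSpace X]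
    [MeasurableSpace Y] [NormedAddCommGroup E] [NormedSpace ℝ E] [CompleteSpace E] {α : Measure X}
    {β : Measure Y}
    [IsFiniteMeasure α] [IsFiniteMeasure β] {F : X × Y → E} (hF : Integrable F (α.prod β))
    (h : ∀ A B, MeasurableSet A → MeasurableSet B → ∫ z in A ×ˢ B, F z ∂α.prod β = 0) :
    F =ᵐ[α.prod β] 0 := by
  have htot : ∫ z, F z ∂α.prod β = 0 := by
    simpa using h Set.univ Set.univ .univ .univ
  refine hF.ae_eq_zero_of_forall_setIntegral_eq_zero fun t ht _ => ?_
  induction t, ht using MeasurableSpace.induction_on_inter generateFrom_prod.symm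
    isPiSystem_prod with
  | empty => simp
  | basic t ht =>
    obtain ⟨A, hA, B, hB, rfl⟩ := ht
    exact h A B hA hB
  | compl t ht ih => rw [setIntegral_compl ht hF, htot, ih (measure_lt_top _ _), sub_zero]
  | iUnion f hd hm ih =>
    rw [integral_iUnion hm hd hF.integrableOn]
    simp [ih _ (measure_lt_top _ _)]

variable {X : Type*} [MeasurableSpace X] {ν : Measure X}

theorem enorm_sq_eq_lintegral (f : Lp ℂ 2 ν) : ‖f‖ₑ ^ 2 = ∫⁻ x, ‖f x‖ₑ ^ 2 ∂ν := by
  rw [Lp.enorm_def, eLpNorm_eq_lintegral_rpow_enorm_toReal (by norm_num) (by norm_num)]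
  rw [← ENNReal.rpow_natCast, ← ENNReal.rpow_mul]
  simp

theorem norm_sq_eq_integral (f : Lp ℂ 2 ν) : ‖f‖ ^ 2 = ∫ x, ‖f x‖ ^ 2 ∂ν := by
  have h : inner ℂ f f = ((‖f‖ ^ 2 : ℝ) : ℂ) := by
    rw [inner_self_eq_norm_sq_to_K]; norm_cast
  rw [L2.inner_def] at h
  simp_rw [inner_self_eq_norm_sq_to_K] at h
  have h2 : ∫ x, ((‖f x‖ : ℂ)) ^ 2 ∂ν = ((∫ x, ‖f x‖ ^ 2 ∂ν : ℝ) : ℂ) := by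
    rw [← integral_complex_ofReal]
    simp
  exact (Complex.ofReal_injective (h2.symm.trans h)).symm

theorem integrable_norm_sq (f : Lp ℂ 2 ν) : Integrable (fun x => ‖f x‖ ^ 2) ν :=
  (Lp.memLp f).integrable_norm_pow (by norm_num)

theorem inner_restrictOp_left {s : Set X} (hs : MeasurableSet s) (f g : Lp ℂ 2 ν) :
    inner ℂ (restrictOp ν s f) g = inner ℂ f (restrictOp ν s g) := by
  rw [L2.inner_def, L2.inner_def]
  refine integral_congr_ae ?_
  filter_upwards [restrictOp_coeFn ν hs f, restrictOp_coeFn ν hs g] with x h1 h2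
  rw [h1, h2]
  by_cases hx : x ∈ s <;> simp [hx]

variable {𝒦 : Lp ℂ 2 ν →L[ℂ] Lp ℂ 2 ν} {K : X → X → ℂ} {s : Set X}

theorem inner_projection_left (h𝒦 : IsStarProjection 𝒦) (f g : Lp ℂ 2 ν) :
    inner ℂ (𝒦 f) g = inner ℂ f (𝒦 g) := by
  have h : ContinuousLinearMap.adjoint 𝒦 = 𝒦 := h𝒦.isSelfAdjoint
  rw [← ContinuousLinearMap.adjoint_inner_right, h]

/-- For an orthogonal projection `𝒦`, the compression `P_s 𝒦 P_s` is `T* T` with `T = 𝒦 P_s`. -/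
theorem adjoint_comp_restrictOp (h𝒦 : IsStarProjection 𝒦) (hs : MeasurableSet s) (f : Lp ℂ 2 ν) :
    ContinuousLinearMap.adjoint (𝒦 ∘L restrictOp ν s) ((𝒦 ∘L restrictOp ν s) f) =
      compression 𝒦 s f := by
  refine ext_inner_left ℂ fun g => ?_
  have h : 𝒦 (𝒦 (restrictOp ν s f)) = 𝒦 (restrictOp ν s f) :=
    congrArg (fun S : Lp ℂ 2 ν →L[ℂ] Lp ℂ 2 ν => S (restrictOp ν s f)) h𝒦.isIdempotentElem.eq
  rw [ContinuousLinearMap.adjoint_inner_right]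
  simp only [compression, ContinuousLinearMap.comp_apply]
  rw [inner_projection_left h𝒦, h, inner_restrictOp_left hs]

theorem inner_compression (h𝒦 : IsStarProjection 𝒦) (hs : MeasurableSet s) (f : Lp ℂ 2 ν) :
    inner ℂ f (compression 𝒦 s f) = ((‖(𝒦 ∘L restrictOp ν s) f‖ ^ 2 : ℝ) : ℂ) := by
  rw [← adjoint_comp_restrictOp h𝒦 hs, ContinuousLinearMap.adjoint_inner_right,
    inner_self_eq_norm_sq_to_K]
  norm_cast

/-- For finite measure sets `A` and `B`, `⟨1_A, 𝒦 1_B⟩ = ∫_A ∫_B K`. -/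
theorem IsProjectionKernel.inner_indicator (hK : IsProjectionKernel 𝒦 K) {A B : Set X}
    (hA : MeasurableSet A) (hB : MeasurableSet B) (hνA : ν A ≠ ∞) (hνB : ν B ≠ ∞) :
    inner ℂ (indicatorConstLp 2 hA hνA (1 : ℂ)) (𝒦 (indicatorConstLp 2 hB hνB (1 : ℂ))) =
      ∫ x in A, ∫ y in B, K x y ∂ν ∂ν := by
  rw [L2.inner_indicatorConstLp_one]
  refine setIntegral_congr_ae hA ?_
  filter_upwards [hK.apply (indicatorConstLp 2 hB hνB (1 : ℂ))] with x hx _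
  rw [hx.2, ← integral_indicator hB]
  refine integral_congr_ae ?_
  filter_upwards [indicatorConstLp_coeFn (p := 2) (hs := hB) (hμs := hνB) (c := (1 : ℂ))] with y hy
  rw [hy]
  by_cases h : y ∈ B <;> simp [h]

theorem IsProjectionKernel.ae_lintegral_lt_top (hK : IsProjectionKernel 𝒦 K) {B : Set X}
    (hB : MeasurableSet B) (hνB : ν B ≠ ∞) : ∀ᵐ x ∂ν, ∫⁻ y in B, ‖K x y‖ₑ ∂ν < ∞ := by
  filter_upwards [hK.apply (indicatorConstLp 2 hB hνB (1 : ℂ))] with x hx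
  have h := hx.1.2
  rw [hasFiniteIntegral_iff_enorm] at h
  rw [← lintegral_indicator hB]
  refine lt_of_eq_of_lt (lintegral_congr_ae ?_) h
  filter_upwards [indicatorConstLp_coeFn (p := 2) (hs := hB) (hμs := hνB) (c := (1 : ℂ))] with y hy
  rw [hy]
  by_cases h : y ∈ B <;> simp [h]

/-- Hermitian symmetry, localized to a finite measure set on which the kernel has bounded
sections, so that it is integrable there. -/
theorem IsProjectionKernel.ae_eq_conj_restrict (h𝒦 : IsStarProjection 𝒦)
    (hK : IsProjectionKernel 𝒦 K) {G : Set X} (hG : MeasurableSet G) (hνG : ν G ≠ ∞) {n : ℕ}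
    (hn : ∀ x ∈ G, ∫⁻ y in G, ‖K x y‖ₑ ∂ν ≤ n) :
    ∀ᵐ z ∂((ν.restrict G).prod (ν.restrict G)),
      K z.2 z.1 = (starRingEnd ℂ) (K z.1 z.2) := by
  have : IsFiniteMeasure (ν.restrict G) := ⟨by simpa using hνG.lt_top⟩
  have hKm : Measurable fun z : X × X => K z.1 z.2 := hK.measurable
  have hKi : Integrable (fun z : X × X => K z.1 z.2) ((ν.restrict G).prod (ν.restrict G)) := by
    refine ⟨hKm.aestronglyMeasurable, ?_⟩
    rw [hasFiniteIntegral_iff_enorm, lintegral_prod _ hKm.enorm.aemeasurable]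
    calc ∫⁻ x in G, ∫⁻ y in G, ‖K x y‖ₑ ∂ν ∂ν ≤ ∫⁻ x in G, n ∂ν := setLIntegral_mono' hG hn
      _ = n * ν G := by simp
      _ < ∞ := ENNReal.mul_lt_top (by simp) hνG.lt_top
  have hKs : Integrable (fun z : X × X => K z.2 z.1) ((ν.restrict G).prod (ν.restrict G)) :=
    hKi.swap
  have hKc : Integrable (fun z : X × X => (starRingEnd ℂ) (K z.1 z.2))
      ((ν.restrict G).prod (ν.restrict G)) :=
    (LinearIsometryEquiv.integrable_comp_iff Complex.conjLIE).2 hKi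
  have key := ae_eq_zero_of_forall_setIntegral_prod_eq_zero (hKs.sub hKc) ?_
  · filter_upwards [key] with z hz
    exact sub_eq_zero.1 hz
  intro A B hA hB
  have hAf : ν (A ∩ G) ≠ ∞ := ne_top_of_le_ne_top hνG (measure_mono Set.inter_subset_right)
  have hBf : ν (B ∩ G) ≠ ∞ := ne_top_of_le_ne_top hνG (measure_mono Set.inter_subset_right)
  simp only [Pi.sub_apply]
  rw [integral_sub hKs.integrableOn hKc.integrableOn, sub_eq_zero, integral_conj,
    setIntegral_prod _ hKi.integrableOn]
  have hsw : ∫ z in A ×ˢ B, K z.2 z.1 ∂((ν.restrict G).prod (ν.restrict G)) =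
      ∫ z in B ×ˢ A, K z.1 z.2 ∂((ν.restrict G).prod (ν.restrict G)) :=
    setIntegral_prod_swap B A fun z : X × X => K z.1 z.2
  rw [hsw, setIntegral_prod _ hKi.integrableOn]
  simp only [Measure.restrict_restrict hA, Measure.restrict_restrict hB]
  rw [← hK.inner_indicator (hA.inter hG) (hB.inter hG) hAf hBf,
    ← hK.inner_indicator (hB.inter hG) (hA.inter hG) hBf hAf, inner_conj_symm,
    inner_projection_left h𝒦]

variable [SigmaFinite ν]

/-- The kernel of an orthogonal projection is Hermitian almost everywhere. -/
theorem IsProjectionKernel.ae_eq_conj (h𝒦 : IsStarProjection 𝒦) (hK : IsProjectionKernel 𝒦 K) :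
    ∀ᵐ z ∂(ν.prod ν), K z.2 z.1 = (starRingEnd ℂ) (K z.1 z.2) := by
  -- exhaust `X × X`, up to a null set, by squares `G m n ×ˢ G m n` on which `K` is integrable
  let S := spanningSets ν
  have hS : ∀ m, MeasurableSet (S m) := measurableSet_spanningSets ν
  have hSf : ∀ m, ν (S m) ≠ ∞ := fun m => (measure_spanningSets_lt_top ν m).ne
  let G : ℕ → ℕ → Set X := fun m n => S m ∩ {x | ∫⁻ y in S m, ‖K x y‖ₑ ∂ν ≤ n}
  have hmeas : ∀ m, Measurable fun x => ∫⁻ y in S m, ‖K x y‖ₑ ∂ν := fun m =>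
    hK.measurable.enorm.lintegral_prod_right'
  have hG : ∀ m n, MeasurableSet (G m n) := fun m n =>
    (hS m).inter (measurableSet_le (hmeas m) measurable_const)
  have h1 : ∀ m n, ∀ᵐ z ∂(ν.prod ν), z ∈ G m n ×ˢ G m n →
      K z.2 z.1 = (starRingEnd ℂ) (K z.1 z.2) := by
    intro m n
    have h2 := hK.ae_eq_conj_restrict h𝒦 (hG m n)
      (ne_top_of_le_ne_top (hSf m) (measure_mono Set.inter_subset_left)) (n := n) fun x hx =>
        (lintegral_mono_set Set.inter_subset_left).trans hx.2
    rw [Measure.prod_restrict, ae_restrict_iff' ((hG m n).prod (hG m n))] at h2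
    exact h2
  have h3 : ∀ᵐ x ∂ν, ∀ m, ∫⁻ y in S m, ‖K x y‖ₑ ∂ν < ∞ :=
    ae_all_iff.2 fun m => hK.ae_lintegral_lt_top (hS m) (hSf m)
  filter_upwards [ae_all_iff.2 fun m => ae_all_iff.2 (h1 m),
    Measure.quasiMeasurePreserving_fst.ae h3, Measure.quasiMeasurePreserving_snd.ae h3]
    with z hz hz1 hz2
  obtain ⟨m1, hm1⟩ := Set.mem_iUnion.1 ((iUnion_spanningSets ν).symm ▸ Set.mem_univ z.1)
  obtain ⟨m2, hm2⟩ := Set.mem_iUnion.1 ((iUnion_spanningSets ν).symm ▸ Set.mem_univ z.2)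
  set m := max m1 m2
  obtain ⟨n1, hn1⟩ := ENNReal.exists_nat_gt (hz1 m).ne
  obtain ⟨n2, hn2⟩ := ENNReal.exists_nat_gt (hz2 m).ne
  refine hz m (max n1 n2) ⟨⟨?_, ?_⟩, ⟨?_, ?_⟩⟩
  · exact monotone_spanningSets ν (le_max_left m1 m2) hm1
  · exact hn1.le.trans (by exact_mod_cast le_max_left n1 n2)
  · exact monotone_spanningSets ν (le_max_right m1 m2) hm2
  · exact hn2.le.trans (by exact_mod_cast le_max_right n1 n2)

/-- The function `x ↦ ∫_s |K(x, y)|² dν(y)`, with values in `[0, ∞]`. For the kernel of an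
orthogonal projection it is the diagonal of the kernel of `𝒦 P_s 𝒦`. -/
noncomputable def kernelMass (ν : Measure X) (K : X → X → ℂ) (s : Set X) (x : X) : ℝ≥0∞ :=
  ∫⁻ y in s, ‖K x y‖ₑ ^ 2 ∂ν

theorem IsProjectionKernel.measurable_kernelMass (hK : IsProjectionKernel 𝒦 K) (s : Set X) :
    Measurable (kernelMass ν K s) :=
  (hK.measurable.enorm.pow_const 2).lintegral_prod_right'

/-- The reproducing property: the sections of the kernel have `L²` norm `K(x, x) = 1`. -/
theorem IsProjectionKernel.ae_kernelMass_univ (h𝒦 : IsStarProjection 𝒦)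
    (hK : IsProjectionKernel 𝒦 K) (hdiag : ∀ᵐ x ∂ν, K x x = 1) :
    ∀ᵐ x ∂ν, kernelMass ν K Set.univ x = 1 := by
  filter_upwards [hK.diagonal, hdiag, Measure.ae_ae_of_ae_prod (hK.ae_eq_conj h𝒦)] with x h1 h2 h3
  have h4 : ∫ y, ‖K x y‖ ^ 2 ∂ν = 1 := by
    have h5 : ∫ y, K x y * K y x ∂ν = ((∫ y, ‖K x y‖ ^ 2 ∂ν : ℝ) : ℂ) := by
      rw [← integral_complex_ofReal]
      refine integral_congr_ae ?_
      filter_upwards [h3] with y hy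
      rw [hy, Complex.mul_conj']
      norm_cast
    rw [← h1, h2] at h5
    exact_mod_cast h5.symm
  -- the Bochner integral is nonzero, hence not a junk value
  have h6 : Integrable (fun y => ‖K x y‖ ^ 2) ν := by
    by_contra h
    rw [integral_undef h] at h4
    exact zero_ne_one h4
  have h7 := ofReal_integral_eq_lintegral_ofReal h6 (ae_of_all _ fun y => by positivity)
  rw [h4, ENNReal.ofReal_one] at h7
  rw [kernelMass, Measure.restrict_univ, h7]
  refine lintegral_congr fun y => ?_
  rw [ENNReal.ofReal_pow (norm_nonneg _), ofReal_norm]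

theorem IsProjectionKernel.ae_kernelMass_le_one (h𝒦 : IsStarProjection 𝒦)
    (hK : IsProjectionKernel 𝒦 K) (hdiag : ∀ᵐ x ∂ν, K x x = 1) (s : Set X) :
    ∀ᵐ x ∂ν, kernelMass ν K s x ≤ 1 := by
  filter_upwards [hK.ae_kernelMass_univ h𝒦 hdiag] with x hx
  exact (lintegral_mono_set (Set.subset_univ s)).trans hx.le

theorem IsProjectionKernel.lintegral_kernelMass (h𝒦 : IsStarProjection 𝒦)
    (hK : IsProjectionKernel 𝒦 K) (hdiag : ∀ᵐ x ∂ν, K x x = 1) (s : Set X) :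
    ∫⁻ x, kernelMass ν K s x ∂ν = ν s := by
  simp only [kernelMass]
  rw [lintegral_lintegral_swap (hK.measurable.enorm.pow_const 2).aemeasurable]
  have h : ∀ᵐ y ∂ν, ∫⁻ x, ‖K x y‖ₑ ^ 2 ∂ν = 1 := by
    filter_upwards [hK.ae_kernelMass_univ h𝒦 hdiag,
      Measure.ae_ae_of_ae_prod (hK.ae_eq_conj h𝒦)] with y h1 h2
    rw [← h1, kernelMass, Measure.restrict_univ]
    refine lintegral_congr_ae ?_
    filter_upwards [h2] with x hx
    rw [hx, RCLike.enorm_conj]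
  rw [lintegral_congr_ae (ae_restrict_of_ae h)]
  simp

/-- For almost every `x`, the operator `𝒦 P_s` evaluated at `x` is the inner product with a vector
(the conjugate of the section `K(x, ·)`, cut off to `s`) whose squared norm is
`∫_s |K(x, y)|² dν(y)`. -/
theorem IsProjectionKernel.ae_exists_inner (h𝒦 : IsStarProjection 𝒦)
    (hK : IsProjectionKernel 𝒦 K) (hdiag : ∀ᵐ x ∂ν, K x x = 1) (hs : MeasurableSet s)
    {ι : Type*} [Countable ι] (f : ι → Lp ℂ 2 ν) :
    ∀ᵐ x ∂ν, ∃ k : Lp ℂ 2 ν, ‖k‖ₑ ^ 2 = kernelMass ν K s x ∧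
      ∀ i, (𝒦 ∘L restrictOp ν s) (f i) x = inner ℂ k (f i) := by
  filter_upwards [hK.ae_kernelMass_le_one h𝒦 hdiag s,
    ae_all_iff.2 fun i => hK.apply (restrictOp ν s (f i))] with x h1 h2
  have hm : Measurable fun y => (starRingEnd ℂ) (K x y) :=
    Complex.continuous_conj.measurable.comp (hK.measurable.comp measurable_prodMk_left)
  have hnorm : ∫⁻ y, ‖s.indicator (fun y => (starRingEnd ℂ) (K x y)) y‖ₑ ^ 2 ∂ν =
      kernelMass ν K s x := by
    rw [kernelMass, ← lintegral_indicator hs]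
    refine lintegral_congr fun y => ?_
    by_cases hy : y ∈ s <;> simp [hy]
  have hL : MemLp (s.indicator fun y => (starRingEnd ℂ) (K x y)) 2 ν := by
    refine ⟨(hm.indicator hs).aestronglyMeasurable, ?_⟩
    rw [eLpNorm_lt_top_iff_lintegral_rpow_enorm_lt_top (by norm_num) (by norm_num)]
    simp only [ENNReal.toReal_ofNat, ENNReal.rpow_ofNat]
    rw [hnorm]
    exact h1.trans_lt ENNReal.one_lt_top
  refine ⟨hL.toLp, ?_, fun i => ?_⟩
  · rw [enorm_sq_eq_lintegral, ← hnorm]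
    refine lintegral_congr_ae ?_
    filter_upwards [hL.coeFn_toLp] with y hy
    rw [hy]
  · rw [ContinuousLinearMap.comp_apply, (h2 i).2, L2.inner_def]
    refine integral_congr_ae ?_
    filter_upwards [hL.coeFn_toLp, restrictOp_coeFn ν hs (f i)] with y h3 h4
    rw [h3, h4]
    by_cases hy : y ∈ s <;> simp [hy, mul_comm]

end Kernel

end DPP

/-! ### The accumulated spectrogram of one set -/

namespace DPP

section Eigenvalues

/-- If the eigenvalues `μ_j ∈ [0, 1]` have sum `τ`, the sum of those beyond the first `N ≥ τ` is at
most `∑ μ_j (1 - μ_j)`. With `m = μ_N`, the first `N` terms contribute at least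
`m ∑_{j<N} (1 - μ_j) ≥ m (τ - ∑_{j<N} μ_j)` to the latter sum and the others at least
`(1 - m) ∑_{j≥N} μ_j`. -/
theorem sub_sum_range_le {μ : ℕ → ℝ} {τ v : ℝ} (hanti : Antitone μ) (h0 : ∀ j, 0 ≤ μ j)
    (h1 : ∀ j, μ j ≤ 1) (hsum : HasSum μ τ)
    (hv : ∀ n, ∑ j ∈ Finset.range n, (μ j - μ j ^ 2) ≤ v) {N : ℕ} (hN : τ ≤ N) :
    τ - ∑ j ∈ Finset.range N, μ j ≤ v := by
  set m := μ N
  set S := ∑ j ∈ Finset.range N, μ j with hS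
  have hhead : m * (N - S) ≤ ∑ j ∈ Finset.range N, (μ j - μ j ^ 2) := by
    have : m * (N - S) = ∑ j ∈ Finset.range N, m * (1 - μ j) := by
      rw [← Finset.mul_sum, Finset.sum_sub_distrib]
      simp [hS]
    rw [this]
    refine Finset.sum_le_sum fun j hj => ?_
    nlinarith [hanti (Finset.mem_range.1 hj).le, h1 j]
  have hbound : ∀ n, m * (N - S) + (1 - m) * (∑ j ∈ Finset.range (N + n), μ j - S) ≤ v := by
    intro n
    refine le_trans ?_ (hv (N + n))
    rw [Finset.sum_range_add, Finset.sum_range_add (fun j => μ j - μ j ^ 2)]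
    refine add_le_add hhead ?_
    rw [← hS, add_sub_cancel_left, Finset.mul_sum]
    refine Finset.sum_le_sum fun j _ => ?_
    nlinarith [hanti (Nat.le_add_right N j), h0 (N + j)]
  have hlim : Tendsto (fun n => m * (N - S) + (1 - m) * (∑ j ∈ Finset.range (N + n), μ j - S)) atTop
      (𝓝 (m * (N - S) + (1 - m) * (τ - S))) := by
    refine tendsto_const_nhds.add (tendsto_const_nhds.mul (Tendsto.sub_const ?_ S))
    have h2 := (tendsto_add_atTop_iff_nat N).2 hsum.tendsto_sum_nat
    simpa only [add_comm N] using h2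
  have := le_of_tendsto' hlim hbound
  nlinarith [h0 N]

end Eigenvalues

section Spectrogram

variable {X : Type*} [MeasurableSpace X] {ν : Measure X} {𝒦 : Lp ℂ 2 ν →L[ℂ] Lp ℂ 2 ν}
  {K : X → X → ℂ} {s : Set X}

theorem integrable_accumulatedSpectrogram (𝒦 : Lp ℂ 2 ν →L[ℂ] Lp ℂ 2 ν) (s : Set X)
    (Φ : ℕ → Lp ℂ 2 ν) : Integrable (accumulatedSpectrogram 𝒦 s Φ) ν :=
  integrable_finsetSum _ fun _ _ => integrable_norm_sq _

variable {μ : ℕ → ℝ} {Φ : ℕ → Lp ℂ 2 ν}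

theorem norm_restrictOp_sq (hs : MeasurableSet s) (f : Lp ℂ 2 ν) :
    ‖restrictOp ν s f‖ ^ 2 = ∫ x in s, ‖f x‖ ^ 2 ∂ν := by
  rw [norm_sq_eq_integral, ← integral_indicator hs]
  refine integral_congr_ae ?_
  filter_upwards [restrictOp_coeFn ν hs f] with x hx
  rw [hx]
  by_cases h : x ∈ s <;> simp [h]

theorem IsSpectralDecomposition.adjoint_apply (h𝒦 : IsStarProjection 𝒦) (hs : MeasurableSet s)
    (hΦ : IsSpectralDecomposition (compression 𝒦 s) μ Φ) (j : ℕ) :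
    ContinuousLinearMap.adjoint (𝒦 ∘L restrictOp ν s) ((𝒦 ∘L restrictOp ν s) (Φ j)) =
      (μ j : ℂ) • Φ j := by
  rw [adjoint_comp_restrictOp h𝒦 hs, hΦ.apply_eq]

theorem IsSpectralDecomposition.norm_apply_sq (h𝒦 : IsStarProjection 𝒦) (hs : MeasurableSet s)
    (hΦ : IsSpectralDecomposition (compression 𝒦 s) μ Φ) (j : ℕ) :
    ‖(𝒦 ∘L restrictOp ν s) (Φ j)‖ ^ 2 = μ j :=
  norm_apply_sq_of_eigenvector (hΦ.orthonormal.1 j) (hΦ.adjoint_apply h𝒦 hs j)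

theorem IsSpectralDecomposition.setIntegral_norm_sq (hs : MeasurableSet s)
    (hΦ : IsSpectralDecomposition (compression 𝒦 s) μ Φ) (j : ℕ) :
    ∫ x in s, ‖(𝒦 ∘L restrictOp ν s) (Φ j) x‖ ^ 2 ∂ν = μ j ^ 2 := by
  rw [← norm_restrictOp_sq hs]
  have h : restrictOp ν s ((𝒦 ∘L restrictOp ν s) (Φ j)) = (μ j : ℂ) • Φ j := hΦ.apply_eq j
  rw [h, norm_smul, hΦ.orthonormal.1 j, mul_one, Complex.norm_real, Real.norm_eq_abs, sq_abs]

/-- The eigenvalues satisfy `μ² = ∫_s |𝒦 P_s Φ|² ≤ ∫ |𝒦 P_s Φ|² = μ`, hence are at most `1`. -/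
theorem IsSpectralDecomposition.eigenvalue_le_one (h𝒦 : IsStarProjection 𝒦) (hs : MeasurableSet s)
    (hΦ : IsSpectralDecomposition (compression 𝒦 s) μ Φ) (j : ℕ) : μ j ≤ 1 := by
  have h := setIntegral_le_integral (s := s)
    (integrable_norm_sq ((𝒦 ∘L restrictOp ν s) (Φ j))) (ae_of_all _ fun x => by positivity)
  rw [hΦ.setIntegral_norm_sq hs, ← norm_sq_eq_integral, hΦ.norm_apply_sq h𝒦 hs] at h
  nlinarith [hΦ.nonneg j]

variable [SigmaFinite ν]

theorem IsProjectionKernel.integrable_kernelMass (h𝒦 : IsStarProjection 𝒦)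
    (hK : IsProjectionKernel 𝒦 K) (hdiag : ∀ᵐ x ∂ν, K x x = 1) (hνs : ν s ≠ ∞) :
    Integrable (fun x => (kernelMass ν K s x).toReal) ν :=
  integrable_toReal_of_lintegral_ne_top (hK.measurable_kernelMass s).aemeasurable
    (hK.lintegral_kernelMass h𝒦 hdiag s ▸ hνs)

theorem IsProjectionKernel.integral_kernelMass (h𝒦 : IsStarProjection 𝒦)
    (hK : IsProjectionKernel 𝒦 K) (hdiag : ∀ᵐ x ∂ν, K x x = 1) :
    ∫ x, (kernelMass ν K s x).toReal ∂ν = ν.real s := by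
  rw [integral_toReal (hK.measurable_kernelMass s).aemeasurable,
    hK.lintegral_kernelMass h𝒦 hdiag s, Measure.real]
  filter_upwards [hK.ae_kernelMass_le_one h𝒦 hdiag s] with x hx
  exact hx.trans_lt ENNReal.one_lt_top

/-- Bessel's inequality for the sections of the kernel. -/
theorem IsProjectionKernel.ae_sum_norm_sq_le (h𝒦 : IsStarProjection 𝒦)
    (hK : IsProjectionKernel 𝒦 K) (hdiag : ∀ᵐ x ∂ν, K x x = 1) (hs : MeasurableSet s)
    (hΦ : Orthonormal ℂ Φ) (n : ℕ) :
    ∀ᵐ x ∂ν, ∑ j ∈ Finset.range n, ‖(𝒦 ∘L restrictOp ν s) (Φ j) x‖ ^ 2 ≤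
      (kernelMass ν K s x).toReal := by
  filter_upwards [hK.ae_exists_inner h𝒦 hdiag hs Φ] with x hx
  obtain ⟨k, hk, hi⟩ := hx
  rw [← hk]
  simp only [hi, ENNReal.toReal_pow, toReal_enorm]
  simpa only [norm_inner_symm k] using! hΦ.sum_inner_products_le k (s := Finset.range n)

/-- `‖g - 1_s‖₁ = 2 (ν(s) - ∫_s g)` for `g(x) = ∫_s |K(x, y)|² dν(y)`, because `0 ≤ g ≤ 1` and
`∫ g = ν(s)`. -/
theorem IsProjectionKernel.integral_abs_kernelMass_sub_indicator (h𝒦 : IsStarProjection 𝒦)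
    (hK : IsProjectionKernel 𝒦 K) (hdiag : ∀ᵐ x ∂ν, K x x = 1) (hs : MeasurableSet s)
    (hνs : ν s ≠ ∞) :
    ∫ x, |(kernelMass ν K s x).toReal - s.indicator (fun _ => (1 : ℝ)) x| ∂ν =
      2 * (ν.real s - ∫ x in s, (kernelMass ν K s x).toReal ∂ν) := by
  have hg := hK.integrable_kernelMass h𝒦 hdiag hνs
  have h1 : Integrable (s.indicator fun _ => (1 : ℝ)) ν :=
    (integrable_indicator_iff hs).2 (integrableOn_const hνs)
  have hgs : Integrable (s.indicator fun x => (kernelMass ν K s x).toReal) ν := hg.indicator hs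
  have h2 : ∫ x, |(kernelMass ν K s x).toReal - s.indicator (fun _ => (1 : ℝ)) x| ∂ν =
      ∫ x, ((s.indicator (fun _ => (1 : ℝ)) x + (kernelMass ν K s x).toReal) -
        2 * s.indicator (fun x => (kernelMass ν K s x).toReal) x) ∂ν := by
    refine integral_congr_ae ?_
    filter_upwards [hK.ae_kernelMass_le_one h𝒦 hdiag s] with x hx
    have hx1 : (kernelMass ν K s x).toReal ≤ 1 := ENNReal.toReal_le_of_le_ofReal zero_le_one
      (by simpa using hx)
    by_cases h : x ∈ s
    · simp only [Set.indicator_of_mem h]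
      rw [abs_of_nonpos (by linarith)]
      ring
    · simp [Set.indicator_of_notMem h]
  have h1g : Integrable (fun x => s.indicator (fun _ => (1 : ℝ)) x +
      (kernelMass ν K s x).toReal) ν := h1.add hg
  rw [h2, integral_sub h1g (hgs.const_mul 2), integral_add h1 hg, integral_const_mul,
    integral_indicator hs, integral_indicator hs, hK.integral_kernelMass h𝒦 hdiag]
  simp
  ring

variable [TopologicalSpace.SeparableSpace (Lp ℂ 2 ν)]

/-- `∑ᵢ ‖𝒦 P_s bᵢ‖² = ν s` for any orthonormal basis: by Parseval's identity under the integral,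
the sum is the squared Hilbert-Schmidt norm `∫ ∫_s |K|²`. -/
theorem IsProjectionKernel.tsum_enorm_sq (h𝒦 : IsStarProjection 𝒦)
    (hK : IsProjectionKernel 𝒦 K) (hdiag : ∀ᵐ x ∂ν, K x x = 1) (hs : MeasurableSet s)
    {ι : Type*} (b : HilbertBasis ι ℂ (Lp ℂ 2 ν)) :
    ∑' i, ‖(𝒦 ∘L restrictOp ν s) (b i)‖ₑ ^ 2 = ν s := by
  have : Countable ι := b.orthonormal.countable
  simp_rw [enorm_sq_eq_lintegral]
  rw [← lintegral_tsum fun i => (Lp.aestronglyMeasurable _).enorm.pow_const 2,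
    ← hK.lintegral_kernelMass h𝒦 hdiag s]
  refine lintegral_congr_ae ?_
  filter_upwards [hK.ae_exists_inner h𝒦 hdiag hs b] with x hx
  obtain ⟨k, hk, hi⟩ := hx
  rw [← hk, ← b.tsum_enorm_inner_sq]
  refine tsum_congr fun i => ?_
  rw [hi, enorm_inner_sq, enorm_inner_sq, norm_inner_symm]

theorem IsProjectionKernel.hasSum_norm_sq (h𝒦 : IsStarProjection 𝒦)
    (hK : IsProjectionKernel 𝒦 K) (hdiag : ∀ᵐ x ∂ν, K x x = 1) (hs : MeasurableSet s)
    (hνs : ν s ≠ ∞) {ι : Type*} (b : HilbertBasis ι ℂ (Lp ℂ 2 ν)) :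
    HasSum (fun i => ‖(𝒦 ∘L restrictOp ν s) (b i)‖ ^ 2) (ν.real s) := by
  have h := hK.tsum_enorm_sq h𝒦 hdiag hs b
  have h2 := ENNReal.hasSum_toReal (h ▸ hνs)
  rw [← ENNReal.tsum_toReal_eq (ENNReal.ne_top_of_tsum_ne_top (h ▸ hνs)), h] at h2
  simpa [Measure.real] using h2

theorem IsProjectionKernel.trace_compression (h𝒦 : IsStarProjection 𝒦)
    (hK : IsProjectionKernel 𝒦 K) (hdiag : ∀ᵐ x ∂ν, K x x = 1) (hs : MeasurableSet s)
    (hνs : ν s ≠ ∞) : trace (compression 𝒦 s) = (ν.real s : ℂ) := by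
  rw [trace]
  simp_rw [inner_compression h𝒦 hs]
  exact (Complex.hasSum_ofReal.2 (hK.hasSum_norm_sq h𝒦 hdiag hs hνs _)).tsum_eq

theorem IsProjectionKernel.hasSum_eigenvalues (h𝒦 : IsStarProjection 𝒦)
    (hK : IsProjectionKernel 𝒦 K) (hdiag : ∀ᵐ x ∂ν, K x x = 1) (hs : MeasurableSet s)
    (hνs : ν s ≠ ∞) (hΦ : IsSpectralDecomposition (compression 𝒦 s) μ Φ) :
    HasSum μ (ν.real s) := by
  obtain ⟨w, b, -⟩ := exists_hilbertBasis ℂ (Lp ℂ 2 ν)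
  have h : ∑' j, ENNReal.ofReal (μ j) = ν s := by
    rw [hΦ.tsum_ofReal b, ← hK.tsum_enorm_sq h𝒦 hdiag hs b]
    refine tsum_congr fun i => ?_
    rw [inner_compression h𝒦 hs, Complex.ofReal_re, ENNReal.ofReal_pow (norm_nonneg _),
      ofReal_norm]
  have h2 := ENNReal.hasSum_toReal (h ▸ hνs)
  rw [← ENNReal.tsum_toReal_eq (ENNReal.ne_top_of_tsum_ne_top (h ▸ hνs)), h] at h2
  simpa [Measure.real, ENNReal.toReal_ofReal, hΦ.nonneg] using h2

/-- The sum of `μ_j (1 - μ_j)` over the eigenvalues of `P_s 𝒦 P_s` is at most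
`ν(s) - ∫_s ∫_s |K|²`. -/
theorem IsProjectionKernel.sum_sub_sq_le (h𝒦 : IsStarProjection 𝒦)
    (hK : IsProjectionKernel 𝒦 K) (hdiag : ∀ᵐ x ∂ν, K x x = 1) (hs : MeasurableSet s)
    (hνs : ν s ≠ ∞) (hΦ : IsSpectralDecomposition (compression 𝒦 s) μ Φ) (n : ℕ) :
    ∑ j ∈ Finset.range n, (μ j - μ j ^ 2) ≤
      ν.real s - ∫ x in s, (kernelMass ν K s x).toReal ∂ν := by
  have hμ := hK.hasSum_eigenvalues h𝒦 hdiag hs hνs hΦ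
  set T := 𝒦 ∘L restrictOp ν s
  have hg := hK.integrable_kernelMass h𝒦 hdiag hνs
  have hT : ∀ j, Integrable (fun x => ‖T (Φ j) x‖ ^ 2) ν := fun j => integrable_norm_sq _
  have hsq : ∀ j, ∫ x in s, ‖T (Φ j) x‖ ^ 2 ∂ν = μ j ^ 2 := hΦ.setIntegral_norm_sq hs
  -- `∫_s (g - ∑_{j<N} |T Φ_j|²) ≤ ∫ (g - ∑_{j<N} |T Φ_j|²) = ν(s) - ∑_{j<N} μ_j`
  have h1 : ∫ x in s, ((kernelMass ν K s x).toReal - ∑ j ∈ Finset.range n, ‖T (Φ j) x‖ ^ 2) ∂ν ≤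
      ∫ x, ((kernelMass ν K s x).toReal - ∑ j ∈ Finset.range n, ‖T (Φ j) x‖ ^ 2) ∂ν := by
    refine setIntegral_le_integral (hg.sub (integrable_finsetSum _ fun j _ => hT j)) ?_
    filter_upwards [hK.ae_sum_norm_sq_le h𝒦 hdiag hs hΦ.orthonormal n] with x hx
    exact sub_nonneg.2 hx
  rw [integral_sub hg.integrableOn (integrable_finsetSum _ fun j _ => (hT j).integrableOn),
    integral_sub hg (integrable_finsetSum _ fun j _ => hT j),
    integral_finsetSum _ fun j _ => (hT j).integrableOn,
    integral_finsetSum _ fun j _ => hT j, hK.integral_kernelMass h𝒦 hdiag] at h1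
  simp_rw [hsq, ← norm_sq_eq_integral] at h1
  rw [Finset.sum_congr rfl fun j _ => hΦ.norm_apply_sq h𝒦 hs j] at h1
  rw [Finset.sum_sub_distrib]
  linarith

/-- The `L¹` distance between the accumulated spectrogram and the indicator function is at most
`1 + 4 (ν(s) - ∫_s ∫_s |K|²)`. -/
theorem IsProjectionKernel.integral_abs_accumulatedSpectrogram_sub_le (h𝒦 : IsStarProjection 𝒦)
    (hK : IsProjectionKernel 𝒦 K) (hdiag : ∀ᵐ x ∂ν, K x x = 1) (hs : MeasurableSet s)
    (hνs : ν s ≠ ∞) (hΦ : IsSpectralDecomposition (compression 𝒦 s) μ Φ) :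
    ∫ x, |accumulatedSpectrogram 𝒦 s Φ x - s.indicator (fun _ => (1 : ℝ)) x| ∂ν ≤
      1 + 4 * (ν.real s - ∫ x in s, (kernelMass ν K s x).toReal ∂ν) := by
  set N := spectrogramCount 𝒦 s with hN
  set g : X → ℝ := fun x => (kernelMass ν K s x).toReal with hgdef
  set v := ν.real s - ∫ x in s, g x ∂ν
  set T := 𝒦 ∘L restrictOp ν s with hTdef
  have hNceil : N = ⌈ν.real s⌉₊ := by
    rw [hN, spectrogramCount, hK.trace_compression h𝒦 hdiag hs hνs, Complex.ofReal_re]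
  have hμ1 := hΦ.eigenvalue_le_one h𝒦 hs
  have htail : ν.real s - ∑ j ∈ Finset.range N, μ j ≤ v :=
    sub_sum_range_le hΦ.antitone hΦ.nonneg hμ1 (hK.hasSum_eigenvalues h𝒦 hdiag hs hνs hΦ)
      (hK.sum_sub_sq_le h𝒦 hdiag hs hνs hΦ) (hNceil ▸ Nat.le_ceil _)
  have hNlt : (N : ℝ) < ν.real s + 1 := hNceil ▸ Nat.ceil_lt_add_one measureReal_nonneg
  have hg : Integrable g ν := hK.integrable_kernelMass h𝒦 hdiag hνs
  have h1 : Integrable (s.indicator fun _ => (1 : ℝ)) ν :=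
    (integrable_indicator_iff hs).2 (integrableOn_const hνs)
  have hT : ∀ j, Integrable (fun x => ‖T (Φ j) x‖ ^ 2) ν := fun j => integrable_norm_sq _
  have hΨ : ∀ j, Integrable (fun x => ‖polarIsometry T (Φ j) x‖ ^ 2) ν :=
    fun j => integrable_norm_sq _
  have hTΨ : ∀ j, ∀ᵐ x ∂ν, ‖T (Φ j) x‖ ^ 2 = μ j * ‖polarIsometry T (Φ j) x‖ ^ 2 := by
    intro j
    have h := sqrt_smul_polarIsometry (hΦ.nonneg j) (hΦ.adjoint_apply h𝒦 hs j)
    filter_upwards [Lp.coeFn_smul (√(μ j) : ℂ) (polarIsometry T (Φ j))] with x hx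
    rw [← hTdef] at h
    rw [← h, hx, Pi.smul_apply, norm_smul, mul_pow, Complex.norm_real, Real.norm_eq_abs, sq_abs,
      Real.sq_sqrt (hΦ.nonneg j)]
  have hΨ1 : ∀ j, ∫ x, ‖polarIsometry T (Φ j) x‖ ^ 2 ∂ν ≤ 1 := by
    intro j
    rw [← norm_sq_eq_integral]
    exact pow_le_one₀ (norm_nonneg _) (norm_polarIsometry_le_of_eigenvector (hΦ.nonneg j)
      (hΦ.orthonormal.1 j) (hΦ.adjoint_apply h𝒦 hs j))
  have hi1 : Integrable (fun x => ∑ j ∈ Finset.range N,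
      (1 - μ j) * ‖polarIsometry T (Φ j) x‖ ^ 2) ν :=
    integrable_finsetSum _ fun j _ => (hΨ j).const_mul _
  have hi2 : Integrable (fun x => g x - ∑ j ∈ Finset.range N, ‖T (Φ j) x‖ ^ 2) ν :=
    hg.sub (integrable_finsetSum _ fun j _ => hT j)
  have hi3 : Integrable (fun x => |g x - s.indicator (fun _ => (1 : ℝ)) x|) ν := (hg.sub h1).abs
  have hi12 : Integrable (fun x =>
      ∑ j ∈ Finset.range N, (1 - μ j) * ‖polarIsometry T (Φ j) x‖ ^ 2 +
        (g x - ∑ j ∈ Finset.range N, ‖T (Φ j) x‖ ^ 2)) ν := hi1.add hi2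
  -- triangle inequality through `∑_{j<N} |T Φ_j|²` and `g`
  have hpt : ∀ᵐ x ∂ν, |accumulatedSpectrogram 𝒦 s Φ x - s.indicator (fun _ => (1 : ℝ)) x| ≤
      ∑ j ∈ Finset.range N, (1 - μ j) * ‖polarIsometry T (Φ j) x‖ ^ 2 +
        (g x - ∑ j ∈ Finset.range N, ‖T (Φ j) x‖ ^ 2) +
        |g x - s.indicator (fun _ => (1 : ℝ)) x| := by
    filter_upwards [ae_all_iff.2 hTΨ, hK.ae_sum_norm_sq_le h𝒦 hdiag hs hΦ.orthonormal N]
      with x hx hb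
    have e : accumulatedSpectrogram 𝒦 s Φ x - ∑ j ∈ Finset.range N, ‖T (Φ j) x‖ ^ 2 =
        ∑ j ∈ Finset.range N, (1 - μ j) * ‖polarIsometry T (Φ j) x‖ ^ 2 := by
      rw [accumulatedSpectrogram, ← Finset.sum_sub_distrib]
      refine Finset.sum_congr rfl fun j _ => ?_
      rw [hx j]
      ring
    have hnn : 0 ≤ ∑ j ∈ Finset.range N, (1 - μ j) * ‖polarIsometry T (Φ j) x‖ ^ 2 :=
      Finset.sum_nonneg fun j _ => mul_nonneg (sub_nonneg.2 (hμ1 j)) (by positivity)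
    have h3 := abs_le.1 (le_refl |g x - s.indicator (fun _ => (1 : ℝ)) x|)
    change ∑ j ∈ Finset.range N, ‖T (Φ j) x‖ ^ 2 ≤ g x at hb
    rw [abs_le]
    constructor <;> linarith [h3.1, h3.2]
  have hi123 : Integrable (fun x =>
      ∑ j ∈ Finset.range N, (1 - μ j) * ‖polarIsometry T (Φ j) x‖ ^ 2 +
        (g x - ∑ j ∈ Finset.range N, ‖T (Φ j) x‖ ^ 2) +
        |g x - s.indicator (fun _ => (1 : ℝ)) x|) ν := hi12.add hi3
  refine (integral_mono_ae ((integrable_accumulatedSpectrogram 𝒦 s Φ).sub h1).abs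
    hi123 hpt).trans ?_
  rw [integral_add hi12 hi3, integral_add hi1 hi2,
    hK.integral_abs_kernelMass_sub_indicator h𝒦 hdiag hs hνs,
    integral_sub hg (integrable_finsetSum _ fun j _ => hT j),
    integral_finsetSum _ fun j _ => hT j, integral_finsetSum _ fun j _ => (hΨ j).const_mul _,
    hK.integral_kernelMass h𝒦 hdiag]
  have hA : ∑ j ∈ Finset.range N, ∫ x, (1 - μ j) * ‖polarIsometry T (Φ j) x‖ ^ 2 ∂ν ≤
      N - ∑ j ∈ Finset.range N, μ j := by
    calc _ ≤ ∑ j ∈ Finset.range N, (1 - μ j) := by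
          refine Finset.sum_le_sum fun j _ => ?_
          rw [integral_const_mul]
          exact mul_le_of_le_one_right (sub_nonneg.2 (hμ1 j)) (hΨ1 j)
      _ = _ := by simp
  have hB : ∑ j ∈ Finset.range N, ∫ x, ‖T (Φ j) x‖ ^ 2 ∂ν = ∑ j ∈ Finset.range N, μ j :=
    Finset.sum_congr rfl fun j _ => by
      rw [← norm_sq_eq_integral, hΦ.norm_apply_sq h𝒦 hs j]
  rw [hB]
  linarith

end Spectrogram

end DPP

/-! ### Moments of the number of points -/

namespace DPP

section Moments

/-- A point of the support of a configuration is an atom: by outer regularity, a point of mass `0`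
has a neighbourhood of mass less than `1`, that is, of mass `0`. -/
theorem Configuration.measure_singleton_ne_zero {X : Type*} [PseudoMetricSpace X]
    [SecondCountableTopology X] [MeasurableSpace X] [BorelSpace X] (ξ : Configuration X) {x : X}
    (hx : x ∈ ξ.1.support) : ξ.1 {x} ≠ 0 := by
  intro h0
  have := ξ.2.1
  obtain ⟨U, hU, hUo, hlt⟩ := Set.exists_isOpen_lt_of_lt ({x} : Set X) 1
    (show ξ.1 {x} < 1 by rw [h0]; exact zero_lt_one)
  obtain ⟨n, hn⟩ := ξ.2.2 U hUo.measurableSet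
  have hpos := (Measure.mem_support_iff_forall x).1 hx U
    (hUo.mem_nhds (hU (Set.mem_singleton x)))
  rw [hn] at hlt hpos
  have h1 : n < 1 := by exact_mod_cast hlt
  rw [Order.lt_one_iff] at h1
  simp [h1] at hpos

variable {X : Type*} [MetricSpace X] [SecondCountableTopology X] [MeasurableSpace X] [BorelSpace X]

/-- A simple configuration of finite mass in `s` counts its finitely many points in `s`. -/
theorem Configuration.finite_and_measure_eq (ξ : Configuration X)
    (hξ : ∀ x : X, ξ.1 {x} = 0 ∨ ξ.1 {x} = 1) {s : Set X} (hs : ξ.1 s ≠ ∞) :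
    (s ∩ ξ.1.support).Finite ∧ ξ.1 s = (s ∩ ξ.1.support).ncard := by
  have h1 : ∀ x ∈ s ∩ ξ.1.support, ξ.1 {x} = 1 := fun x hx =>
    (hξ x).resolve_left (ξ.measure_singleton_ne_zero hx.2)
  have hcard : ∀ t : Finset X, (t : Set X) ⊆ s ∩ ξ.1.support → ξ.1 (t : Set X) = t.card := by
    intro t ht
    rw [← sum_measure_singleton, Finset.sum_congr rfl fun x hx => h1 x (ht hx)]
    simp
  have hfin : (s ∩ ξ.1.support).Finite := by
    by_contra hinf
    obtain ⟨n, hn⟩ := ENNReal.exists_nat_gt hs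
    obtain ⟨t, ht, htn⟩ := Set.Infinite.exists_subset_card_eq hinf n
    have h2 := hcard t ht
    rw [htn] at h2
    exact (h2 ▸ (measure_mono (ht.trans Set.inter_subset_left))).not_gt hn
  refine ⟨hfin, ?_⟩
  have h3 : ξ.1 s = ξ.1 (s ∩ ξ.1.support) :=
    (measure_inter_conull' (measure_mono_null (fun x hx => hx.2)
      Measure.measure_compl_support)).symm
  rw [h3, Set.ncard_eq_toFinset_card _ hfin, ← hcard _ (by simp)]
  simp

open Classical in
/-- The number of injective `n`-tuples in a finite set `s ∩ S`, as a sum over injective tuples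
in `S`. -/
theorem tsum_injective_indicator {Y : Type*} (S s : Set Y) (hf : (s ∩ S).Finite) (n : ℕ) :
    ∑' x : {x : Fin n → Y // Function.Injective x ∧ ∀ i, x i ∈ S},
      (Set.univ.pi fun _ => s).indicator (fun _ => (1 : ℝ≥0∞)) x.1 =
      ((s ∩ S).ncard.descFactorial n : ℕ) := by
  have := hf.fintype
  let A : Set (Fin n → Y) := {x | Function.Injective x ∧ ∀ i, x i ∈ S}
  let e : (A ∩ Set.univ.pi fun _ => s : Set (Fin n → Y)) ≃ (Fin n ↪ (s ∩ S : Set Y)) :=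
    { toFun := fun x => ⟨fun i => ⟨x.1 i, x.2.2 i trivial, x.2.1.2 i⟩,
        fun i j h => x.2.1.1 (congrArg Subtype.val h)⟩
      invFun := fun f => ⟨fun i => f i, ⟨fun i j h => f.injective (Subtype.ext h),
        fun i => (f i).2.2⟩, fun i _ => (f i).2.1⟩
      left_inv := fun _ => rfl
      right_inv := fun _ => rfl }
  change ∑' x : A, (Set.univ.pi fun _ => s).indicator (fun _ => (1 : ℝ≥0∞)) x.1 = _
  rw [tsum_subtype A, Set.indicator_indicator,
    ← tsum_subtype (A ∩ Set.univ.pi fun _ => s) fun _ => (1 : ℝ≥0∞), ← e.symm.tsum_eq,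
    tsum_fintype, Finset.sum_const, Finset.card_univ, Fintype.card_embedding_eq, Fintype.card_fin,
    Set.ncard_eq_toFinset_card', Set.toFinset_card]
  simp

/-- The factorial moments of the number of points in `s` are the integrals of the correlation
functions over `s ^ n`. -/
theorem IsCorrelationFunction.lintegral_descFactorial {P : Measure (Configuration X)}
    {ν : Measure X} {n : ℕ} {ρ : (Fin n → X) → ℂ} (h : IsCorrelationFunction P ν n ρ)
    (hP : IsSimple P) {s : Set X} (hs : MeasurableSet s)
    (hfin : ∀ ξ : Configuration X, ξ.1 s ≠ ∞) :
    ∫⁻ ξ, ((s ∩ ξ.1.support).ncard.descFactorial n : ℕ) ∂P =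
      ∫⁻ x in Set.univ.pi fun _ => s, ENNReal.ofReal (ρ x).re ∂(Measure.pi fun _ => ν) := by
  have hsn : MeasurableSet (Set.univ.pi fun _ : Fin n => s) := MeasurableSet.univ_pi fun _ => hs
  have h1 := h.lintegral_sum ((Set.univ.pi fun _ => s).indicator fun _ => 1)
    (measurable_const.indicator hsn)
  rw [← lintegral_indicator hsn]
  convert! h1 using 1
  · refine lintegral_congr_ae ?_
    filter_upwards [hP] with ξ hξ
    rw [tsum_injective_indicator _ _ (ξ.finite_and_measure_eq hξ (hfin ξ)).1]
  · refine lintegral_congr fun x => ?_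
    by_cases hx : x ∈ Set.univ.pi fun _ : Fin n => s <;> simp [hx]

variable {P : Measure (Configuration X)} {ν : Measure X} {K : X → X → ℂ} {s : Set X}

theorem ae_count_eq (hP : IsSimple P) (hfin : ∀ ξ : Configuration X, ξ.1 s ≠ ∞) :
    ∀ᵐ ξ ∂P, count s ξ = (s ∩ ξ.1.support).ncard := by
  filter_upwards [hP] with ξ hξ
  rw [count, (ξ.finite_and_measure_eq hξ (hfin ξ)).2]
  simp

theorem IsDeterminantal.integral_count (hP : IsDeterminantal P ν K)
    (hdiag : ∀ᵐ x ∂ν, K x x = 1) (hs : MeasurableSet s)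
    (hfin : ∀ ξ : Configuration X, ξ.1 s ≠ ∞) (hL : Integrable (count s) P) :
    ∫ ξ, count s ξ ∂P = ν.real s := by
  have h1 := (hP.correlation 1 le_rfl).lintegral_descFactorial hP.simple hs hfin
  rw [integral_eq_lintegral_of_nonneg_ae (f := count s)
      (ae_of_all _ fun ξ => ENNReal.toReal_nonneg) hL.1,
    Measure.real]
  congr 1
  have h2 : ∫⁻ ξ, ENNReal.ofReal (count s ξ) ∂P =
      ∫⁻ ξ, ((s ∩ ξ.1.support).ncard.descFactorial 1 : ℕ) ∂P := by
    refine lintegral_congr_ae ?_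
    filter_upwards [ae_count_eq hP.simple hfin] with ξ hξ
    rw [hξ]
    simp
  have hpre : Set.univ.pi (fun _ : Fin 1 => s) =
      MeasurableEquiv.funUnique (Fin 1) X ⁻¹' s := by
    ext x
    simp [MeasurableEquiv.funUnique, Fin.forall_fin_one]
  rw [h2, h1, hpre]
  have hmp := measurePreserving_funUnique ν (Fin 1)
  have h3 := hmp.setLIntegral_comp_preimage_emb
    (MeasurableEquiv.measurableEmbedding _) (fun x => ENNReal.ofReal (K x x).re) s
  have h4 : ∫⁻ x in s, ENNReal.ofReal (K x x).re ∂ν = ν s := by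
    rw [lintegral_congr_ae (ae_restrict_of_ae (hdiag.mono fun x hx => by rw [hx]))]
    simp
  rw [← h4, ← h3]
  refine lintegral_congr fun x => ?_
  simp [MeasurableEquiv.funUnique]

variable [SigmaFinite ν]

/-- The number variance of a determinantal point process whose kernel is that of an orthogonal
projection with `K(x, x) = 1` is `ν(s) - ∫_s ∫_s |K|²`. -/
theorem IsDeterminantal.variance_count [IsProbabilityMeasure P]
    {𝒦 : Lp ℂ 2 ν →L[ℂ] Lp ℂ 2 ν} (h𝒦 : IsStarProjection 𝒦)
    (hK : IsProjectionKernel 𝒦 K) (hP : IsDeterminantal P ν K)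
    (hdiag : ∀ᵐ x ∂ν, K x x = 1) (hs : MeasurableSet s) (hνs : ν s ≠ ∞)
    (hfin : ∀ ξ : Configuration X, ξ.1 s ≠ ∞) (hL : MemLp (count s) 2 P) :
    ProbabilityTheory.variance (count s) P =
      ν.real s - ∫ x in s, (kernelMass ν K s x).toReal ∂ν := by
  have hcor := hP.correlation 2 (by norm_num)
  have h1 := hcor.lintegral_descFactorial hP.simple hs hfin
  have hi : Integrable (count s) P := hL.integrable (by norm_num)
  have hi2 : Integrable (fun ξ => count s ξ ^ 2) P := hL.integrable_sq
  have hsq : Integrable (fun ξ => count s ξ ^ 2 - count s ξ) P := hi2.sub hi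
  have hnc : ∀ᵐ ξ ∂P, count s ξ ^ 2 - count s ξ =
      ((s ∩ ξ.1.support).ncard.descFactorial 2 : ℕ) := by
    filter_upwards [ae_count_eq hP.simple hfin] with ξ hξ
    rw [hξ]
    generalize (s ∩ ξ.1.support).ncard = m
    cases m with
    | zero => simp
    | succ m => simp [Nat.descFactorial]; ring
  have hnn : 0 ≤ᵐ[P] fun ξ => count s ξ ^ 2 - count s ξ := by
    filter_upwards [hnc] with ξ hξ
    rw [hξ]
    positivity
  -- `𝔼[ξ(s)² - ξ(s)] + ∫_s ∫_s |K|² = ν(s)²`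
  have hmoment : ENNReal.ofReal (∫ ξ, (count s ξ ^ 2 - count s ξ) ∂P) +
      ∫⁻ x in s, kernelMass ν K s x ∂ν = ν s * ν s := by
    have h2 : ∫⁻ ξ, ENNReal.ofReal (count s ξ ^ 2 - count s ξ) ∂P =
        ∫⁻ ξ, ((s ∩ ξ.1.support).ncard.descFactorial 2 : ℕ) ∂P := by
      refine lintegral_congr_ae ?_
      filter_upwards [hnc] with ξ hξ
      rw [hξ, ENNReal.ofReal_natCast]
    have hmp := measurePreserving_piFinTwo (fun _ : Fin 2 => ν)
    have hpre : Set.univ.pi (fun _ : Fin 2 => s) =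
        MeasurableEquiv.piFinTwo (fun _ : Fin 2 => X) ⁻¹' (s ×ˢ s) := by
      ext x
      simp [MeasurableEquiv.piFinTwo, Fin.forall_fin_two]
    have h3 := hmp.setLIntegral_comp_preimage_emb (MeasurableEquiv.measurableEmbedding _)
      (fun z : X × X => ENNReal.ofReal (K z.1 z.1 * K z.2 z.2 - K z.1 z.2 * K z.2 z.1).re) (s ×ˢ s)
    have h4 : ∀ᵐ z ∂(ν.prod ν), 0 ≤ (K z.1 z.1 * K z.2 z.2 - K z.1 z.2 * K z.2 z.1).re := by
      have h5 := hcor.nonneg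
      rw [← hmp.symm.map_eq, (MeasurableEquiv.measurableEmbedding _).ae_map_iff] at h5
      filter_upwards [h5] with z hz
      simpa [Matrix.det_fin_two, MeasurableEquiv.piFinTwo] using hz.1
    rw [ofReal_integral_eq_lintegral_ofReal hsq hnn, h2, h1, hpre]
    have h6 : ∫⁻ x in MeasurableEquiv.piFinTwo (fun _ : Fin 2 => X) ⁻¹' (s ×ˢ s),
        ENNReal.ofReal (Matrix.of fun i j => K (x i) (x j)).det.re ∂(Measure.pi fun _ => ν) =
        ∫⁻ z in s ×ˢ s, ENNReal.ofReal
          (K z.1 z.1 * K z.2 z.2 - K z.1 z.2 * K z.2 z.1).re ∂(ν.prod ν) := by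
      rw [← h3]
      refine lintegral_congr fun x => ?_
      simp [Matrix.det_fin_two, MeasurableEquiv.piFinTwo]
    have hm2 : Measurable fun z : X × X => ‖K z.1 z.2‖ₑ ^ 2 := hK.measurable.enorm.pow_const 2
    have h7 : ∫⁻ x in s, kernelMass ν K s x ∂ν = ∫⁻ z in s ×ˢ s, ‖K z.1 z.2‖ₑ ^ 2 ∂(ν.prod ν) := by
      rw [← Measure.prod_restrict, lintegral_prod _ hm2.aemeasurable]
      rfl
    rw [h6, h7, ← lintegral_add_right _ hm2, ← Measure.prod_prod, ← setLIntegral_one]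
    refine lintegral_congr_ae (ae_restrict_of_ae ?_)
    filter_upwards [h4, hK.ae_eq_conj h𝒦, Measure.quasiMeasurePreserving_fst.ae hdiag,
      Measure.quasiMeasurePreserving_snd.ae hdiag] with z hz hc hd1 hd2
    have h8 : (K z.1 z.1 * K z.2 z.2 - K z.1 z.2 * K z.2 z.1).re = 1 - ‖K z.1 z.2‖ ^ 2 := by
      rw [hd1, hd2, hc, Complex.mul_conj', ← Complex.ofReal_pow, mul_one,
        Complex.sub_re, Complex.one_re, Complex.ofReal_re]
    rw [h8] at hz ⊢
    rw [← ofReal_norm, ← ENNReal.ofReal_pow (norm_nonneg _),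
      ← ENNReal.ofReal_add hz (by positivity)]
    simp
  have hmass : ∫ x in s, (kernelMass ν K s x).toReal ∂ν =
      (∫⁻ x in s, kernelMass ν K s x ∂ν).toReal := by
    refine integral_toReal (hK.measurable_kernelMass s).aemeasurable (ae_restrict_of_ae ?_)
    filter_upwards [hK.ae_kernelMass_le_one h𝒦 hdiag s] with x hx
    exact hx.trans_lt ENNReal.one_lt_top
  have hreal := congrArg ENNReal.toReal hmoment
  have hfin2 : ∫⁻ x in s, kernelMass ν K s x ∂ν ≠ ∞ := by
    refine ne_top_of_le_ne_top (ENNReal.mul_ne_top hνs hνs) (hmoment ▸ le_add_self)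
  rw [ENNReal.toReal_add ENNReal.ofReal_ne_top hfin2, ← hmass,
    ENNReal.toReal_ofReal (integral_nonneg_of_ae hnn), integral_sub hi2 hi, ENNReal.toReal_mul,
    hP.integral_count hdiag hs hfin hi] at hreal
  rw [ProbabilityTheory.variance_eq_sub hL, hP.integral_count hdiag hs hfin hi]
  change ∫ ξ, count s ξ ^ 2 ∂P - _ = _
  change _ = ν.real s * ν.real s at hreal
  linarith

end Moments

end DPP

/-! ### Rescaling -/

theorem corollary1p2 (d : ℕ) (hd : 1 ≤ d)
    (Λ : Set (EuclideanSpace ℝ (Fin d))) (hΛ : MeasurableSet Λ) (hΛb : Bornology.IsBounded Λ)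
    (𝒦 : Lp ℂ 2 (volume : Measure (EuclideanSpace ℝ (Fin d))) →L[ℂ]
      Lp ℂ 2 (volume : Measure (EuclideanSpace ℝ (Fin d))))
    (h𝒦 : IsStarProjection 𝒦) (h𝒦tc : DPP.IsLocallyTraceClass 𝒦)
    (K : EuclideanSpace ℝ (Fin d) → EuclideanSpace ℝ (Fin d) → ℂ)
    (hK : DPP.IsProjectionKernel 𝒦 K) (hKdiag : ∀ᵐ x, K x x = 1)
    (P : Measure (DPP.Configuration (EuclideanSpace ℝ (Fin d)))) [IsProbabilityMeasure P]
    (hP : DPP.IsDeterminantal P volume K)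
    (hyper : DPP.IsHyperuniformAlong P (fun R : ℝ => R • Λ) atTop)
    (μ : ℝ → ℕ → ℝ) (Φ : ℝ → ℕ → Lp ℂ 2 (volume : Measure (EuclideanSpace ℝ (Fin d))))
    (hΦ : ∀ R : ℝ, 0 < R →
      DPP.IsSpectralDecomposition (DPP.compression 𝒦 (R • Λ)) (μ R) (Φ R)) :
    (∀ R : ℝ, 0 < R →
      MemLp (fun x => DPP.accumulatedSpectrogram 𝒦 (R • Λ) (Φ R) (R • x)) 1 volume) ∧
    Tendsto (fun R : ℝ => eLpNorm (fun x =>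
        DPP.accumulatedSpectrogram 𝒦 (R • Λ) (Φ R) (R • x) - Λ.indicator (fun _ => (1 : ℝ)) x)
      1 volume) atTop (𝓝 0) := by
  have hmeas : ∀ R : ℝ, 0 < R → MeasurableSet (R • Λ) := fun R hR => hΛ.const_smul₀ R
  have hbdd : ∀ R : ℝ, Bornology.IsBounded (R • Λ) := fun R => hΛb.smul₀ R
  have hvol : ∀ R : ℝ, volume (R • Λ) ≠ ∞ := fun R => (hbdd R).measure_lt_top.ne
  have hcfg : ∀ (R : ℝ) (ξ : DPP.Configuration (EuclideanSpace ℝ (Fin d))), ξ.1 (R • Λ) ≠ ∞ :=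
    fun R ξ => by
      have := ξ.2.1
      exact (hbdd R).measure_lt_top.ne
  have hL2 : ∀ R : ℝ, 0 < R → MemLp (DPP.count (R • Λ)) 2 P := fun R hR =>
    hyper.memLp _ (hmeas R hR) (hbdd R)
  have hmean : ∀ R : ℝ, 0 < R → ∫ ξ, DPP.count (R • Λ) ξ ∂P = volume.real (R • Λ) := fun R hR =>
    hP.integral_count hKdiag (hmeas R hR) (hcfg R) ((hL2 R hR).integrable (by norm_num))
  have hscale : ∀ R : ℝ, 0 < R → volume.real (R • Λ) = R ^ d * volume.real Λ := by
    intro R hR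
    rw [Measure.real, Measure.addHaar_smul_of_nonneg _ hR.le, ENNReal.toReal_mul,
      ENNReal.toReal_ofReal (by positivity), finrank_euclideanSpace_fin]
    rfl
  -- a null set `Λ` is excluded, as the expected number of points in `R • Λ` would vanish
  have hpos : 0 < volume.real Λ := by
    obtain ⟨R, hR, hR0⟩ := ((hyper.tendsto_expectation.eventually_gt_atTop 0).and
      (eventually_gt_atTop 0)).exists
    rw [hmean R hR0, hscale R hR0] at hR
    exact pos_of_mul_pos_right hR (by positivity)
  have hint : ∀ R : ℝ, 0 < R → Integrable (fun x => DPP.accumulatedSpectrogram 𝒦 (R • Λ) (Φ R) x -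
      (R • Λ).indicator (fun _ => (1 : ℝ)) x) volume := fun R hR =>
    (DPP.integrable_accumulatedSpectrogram 𝒦 _ _).sub
      ((integrable_indicator_iff (hmeas R hR)).2 (integrableOn_const (hvol R)))
  refine ⟨fun R hR => memLp_one_iff_integrable.2
    ((DPP.integrable_accumulatedSpectrogram 𝒦 _ _).comp_smul hR.ne'), ?_⟩
  have hbound : ∀ R : ℝ, 0 < R → eLpNorm (fun x =>
      DPP.accumulatedSpectrogram 𝒦 (R • Λ) (Φ R) (R • x) - Λ.indicator (fun _ => (1 : ℝ)) x)
      1 volume ≤ ENNReal.ofReal ((R ^ d)⁻¹ + 4 * volume.real Λ *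
        (ProbabilityTheory.variance (DPP.count (R • Λ)) P /
          ∫ ξ, DPP.count (R • Λ) ξ ∂P)) := by
    intro R hR
    set F : EuclideanSpace ℝ (Fin d) → ℝ := fun x =>
      DPP.accumulatedSpectrogram 𝒦 (R • Λ) (Φ R) x - (R • Λ).indicator (fun _ => (1 : ℝ)) x with hF
    have hcomp : (fun x => DPP.accumulatedSpectrogram 𝒦 (R • Λ) (Φ R) (R • x) -
        Λ.indicator (fun _ => (1 : ℝ)) x) = fun x => F (R • x) := by
      ext x
      by_cases hx : x ∈ Λ <;> simp [hF, Set.smul_mem_smul_set_iff₀ hR.ne', hx]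
    have hFi : Integrable (fun x => F (R • x)) volume := (hint R hR).comp_smul hR.ne'
    rw [hcomp, eLpNorm_one_eq_lintegral_enorm, ← ofReal_integral_norm_eq_lintegral_enorm hFi]
    refine ENNReal.ofReal_le_ofReal ?_
    have : Fact ((2 : ℝ≥0∞) ≠ ∞) := ⟨by norm_num⟩
    have hle := hK.integral_abs_accumulatedSpectrogram_sub_le h𝒦 hKdiag (hmeas R hR) (hvol R)
      (hΦ R hR)
    rw [← hP.variance_count h𝒦 hK hKdiag (hmeas R hR) (hvol R) (hcfg R) (hL2 R hR)] at hle
    have hi := Measure.integral_comp_smul_of_nonneg (μ := volume) (fun x => ‖F x‖) R (hR := hR.le)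
    rw [hi, finrank_euclideanSpace_fin, hmean R hR, hscale R hR, smul_eq_mul]
    have hRd : 0 < R ^ d := by positivity
    calc (R ^ d)⁻¹ * ∫ x, ‖F x‖ ≤
        (R ^ d)⁻¹ * (1 + 4 * ProbabilityTheory.variance (DPP.count (R • Λ)) P) := by
          gcongr
          exact hle
      _ = _ := by field_simp
  refine tendsto_of_tendsto_of_tendsto_of_le_of_le' tendsto_const_nhds ?_
    (Eventually.of_forall fun _ => zero_le) ((eventually_gt_atTop 0).mono hbound)
  have h1 : Tendsto (fun R : ℝ => (R ^ d)⁻¹) atTop (𝓝 0) :=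
    tendsto_inv_atTop_zero.comp (tendsto_pow_atTop (by omega))
  have h2 := ENNReal.tendsto_ofReal (h1.add (hyper.tendsto_ratio.const_mul (4 * volume.real Λ)))
  simpa using h2
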